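/- Let $(x_{ij})_{i,j\ge 0}$ be real random variables on a probability space $(\Omega,\mathcal F,\mathbb P)$ with $x_{ij}=x_{ji}$ such that the variables $x_{ij}$, $0\le i\le j$, are independent and have mean zero, the off-diagonal variables $x_{ij}$ ($i<j$) are identically distributed with variance one, the diagonal variables $x_{ii}$ are identically distributed, and all moments are finite: $\mathbb E|x_{ij}|^k<\infty$ for all $i,j,k$. For $N\ge 1$ and a real number $d\neq 0$ let $$W_N=\frac1{\sqrt N}\,[x_{ij}]_{i,j=0}^{N},\qquad H_N^{(d)}=\begin{pmatrix} d&0\\0&I_N\end{pmatrix},\qquad X_N^{(d)}=H_N^{(d)}W_N ,$$ and let $e_0$ be the first vector of the canonical basis of $\mathbb R^{N+1}$. For $m\ge 0$ let $D_m$ be the set of Dyck paths of order $m$, i.e. of walks from $(0,0)$ to $(2m,0)$ with steps $(1,1)$ and $(1,-1)$ that never go below the horizontal axis; for $w\in D_m$ let $\xi(w)$ be the number of points $(i,0)$ with $0\le i<2m$ on $w$ (the meetings of $w$ with the axis, the endpoint $(2m,0)$ excluded), and put $\pi^{(d)}_m=\sum_{w\in D_m}d^{\,\xi(w)}$, so that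 $\pi_0^{(d)}=1$. Then for every integer $n\ge 0$ the random variables $e_0^*\big(X_N^{(d)}\big)^n e_0$ belong to $L^2(\mathbb P)$ and, as $N\to\infty$, $$e_0^*\big(X_N^{(d)}\big)^n e_0\;\longrightarrow\;\begin{cases}\pi^{(d)}_{n/2}, & n \text{ even},\\ 0, & n\text{ odd},\end{cases}$$ in $L^2(\mathbb P)$, and hence also in probability. -/

import Mathlib

open MeasureTheory ProbabilityTheory Filter Topology

noncomputable section

/-- The number `ξ(w)` of meetings of the Dyck path `w` with the horizontal axis, not counting its
endpoint. After `i` steps the path is on the axis iff the first `i` steps contain as many up-steps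
as down-steps; `i` runs over `0, …, 2m - 1` for a path of order `m`. -/
def dyckXi (w : DyckWord) : ℕ :=
  ((Finset.range w.toList.length).filter fun i =>
    (w.toList.take i).count DyckStep.U = (w.toList.take i).count DyckStep.D).card

/-- `π_m^{(d)} = ∑_{w ∈ D_m} d ^ ξ(w)`, the sum being over all Dyck paths of order `m`
(for `m = 0` this is `1`). -/
def dyckPi (d : ℝ) (m : ℕ) : ℝ :=
  ∑ w : {w : DyckWord // w.semilength = m}, d ^ dyckXi w.1

/-- The probabilistic assumptions on the entries `x i j` of a real Wigner matrix. -/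
structure IsWignerArray {Ω : Type*} [MeasurableSpace Ω] (P : Measure Ω)
    (x : ℕ → ℕ → Ω → ℝ) : Prop where
  measurable : ∀ i j, Measurable (x i j)
  symm : ∀ i j, x i j = x j i
  indep : iIndepFun (fun p : {p : ℕ × ℕ // p.1 ≤ p.2} => x p.1.1 p.1.2) P
  identDistrib_offDiag : ∀ i j, i < j → IdentDistrib (x i j) (x 0 1) P P
  identDistrib_diag : ∀ i, IdentDistrib (x i i) (x 0 0) P P
  /-- All moments are finite. -/
  integrable_abs_pow : ∀ (k i j : ℕ), Integrable (fun ω => |x i j ω| ^ k) P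
  mean_zero : ∀ i j, ∫ ω, x i j ω ∂P = 0
  variance_offDiag : ∀ i j, i < j → Var[x i j; P] = 1

/-- `W_N = N^{-1/2} [x i j]_{i,j = 0}^N`. -/
def wignerMatrix {Ω : Type*} (x : ℕ → ℕ → Ω → ℝ) (N : ℕ) (ω : Ω) :
    Matrix (Fin (N + 1)) (Fin (N + 1)) ℝ :=
  (1 / √(N : ℝ)) • Matrix.of fun i j : Fin (N + 1) => x (i : ℕ) (j : ℕ) ω

/-- `H_N^{(d)} = diag(d, 1, …, 1)`, of size `N + 1`. -/
def perturbMatrix (d : ℝ) (N : ℕ) : Matrix (Fin (N + 1)) (Fin (N + 1)) ℝ :=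
  Matrix.diagonal fun i => if i = 0 then d else 1

/-- `X_N^{(d)} = H_N^{(d)} W_N`. -/
def productMatrix {Ω : Type*} (d : ℝ) (x : ℕ → ℕ → Ω → ℝ) (N : ℕ) (ω : Ω) :
    Matrix (Fin (N + 1)) (Fin (N + 1)) ℝ :=
  perturbMatrix d N * wignerMatrix x N ω

/-- The first vector `e_0` of the canonical basis of `ℝ^{N+1}`. -/
def basisVec (N : ℕ) : Fin (N + 1) → ℝ := Pi.single 0 1

/-- The random variable `e_0^* (X_N^{(d)})^n e_0`. -/
def zeroMoment {Ω : Type*} (d : ℝ) (x : ℕ → ℕ → Ω → ℝ) (n N : ℕ) (ω : Ω) : ℝ :=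
  dotProduct (basisVec N) ((productMatrix d x N ω ^ n).mulVec (basisVec N))

end

/-! Let M = N^{-1/2}[x_ij], let T be the index set S without r, and let w_n and E_m denote `walkSum`
at (r, r) and `excursionSum`. Cutting a closed walk at its first return to r gives w_{n+1} = M_rr
w_n + ∑_{m<n} E_m w_{n-1-m} (`walkSum_succ_diag`). Multiplying row r by d multiplies M_rr and every
E_m by d. Dyck paths, cut at their first return to the axis, obey the limiting recurrence
`limitMoment_succ`: the starting point contributes d, and the path inside the first arch is counted
with weight 1. Since M_rr tends to 0, it remains to show that E_m tends to `limitMoment 1 m`.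

E_m is a quadratic form in row r of M whose matrix, the m-th power of M restricted to T, is
independent of that row. Given this matrix, the mean of E_m is N^{-1} tr M_T^m and its variance is
O(N^{-2} tr M_T^{2m}) (`exists_integral_quadratic_form_sub_trace_sq_le`). The normalized trace is an
average of closed walk sums on T, to which the case d = 1 for the shorter length m applies. This is
a strong induction on length, run over arbitrary sequences of index sets `S N` with |S N| ≤ N + 1
and |S N| / N → 1 and base points `r N`: erasing a point preserves the hypotheses, and an average is
controlled by its worst base point.

Limits must be multiplied, so convergence is proved in every L^p. The a priori bounds
`momentBounded_walkSum` follow from the same recurrence and the moment inequality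
`exists_integral_sum_pow_le`; they upgrade L² convergence to L^p. -/

/-! ### Walk sums and the first-return decomposition. -/

section WalkSum

variable {ι : Type*} [DecidableEq ι]

/-- The `(i, j)` entry of the `n`-th power of the array `M` restricted to the indices in `S`:
the sum of the weights of all walks of length `n` from `i` to `j` whose steps end in `S`. -/
noncomputable def walkSum (M : ι → ι → ℝ) (S : Finset ι) : ℕ → ι → ι → ℝ
  | 0, i, j => if i = j then 1 else 0
  | n + 1, i, j => ∑ k ∈ S, M i k * walkSum M S n k j

/-- The total weight of walks from `r` to `r` with `m + 2` steps which avoid `r` in between. -/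
noncomputable def excursionSum (M : ι → ι → ℝ) (S : Finset ι) (r : ι) (m : ℕ) : ℝ :=
  ∑ i ∈ S.erase r, ∑ j ∈ S.erase r, M r i * walkSum M (S.erase r) m i j * M j r

theorem walkSum_zero (M : ι → ι → ℝ) (S : Finset ι) (i j : ι) :
    walkSum M S 0 i j = if i = j then 1 else 0 := rfl

theorem walkSum_succ (M : ι → ι → ℝ) (S : Finset ι) (n : ℕ) (i j : ι) :
    walkSum M S (n + 1) i j = ∑ k ∈ S, M i k * walkSum M S n k j := rfl

theorem walkSum_congr {M M' : ι → ι → ℝ} {S : Finset ι}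
    (h : ∀ i ∈ S, ∀ j ∈ S, M i j = M' i j) (n : ℕ) (j : ι) :
    ∀ i ∈ S, walkSum M S n i j = walkSum M' S n i j := by
  induction n with
  | zero => intro i _; rfl
  | succ n ih =>
    intro i hi
    rw [walkSum_succ, walkSum_succ]
    exact Finset.sum_congr rfl fun k hk => by rw [h i hi k hk, ih k hk]

theorem walkSum_add (M : ι → ι → ℝ) (S : Finset ι) (m n : ℕ) (j : ι) :
    ∀ i ∈ S, walkSum M S (m + n) i j = ∑ k ∈ S, walkSum M S m i k * walkSum M S n k j := by
  induction m with
  | zero =>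
    intro i hi
    simp [walkSum_zero, hi]
  | succ m ih =>
    intro i hi
    rw [add_right_comm, walkSum_succ]
    simp_rw [walkSum_succ, Finset.sum_mul]
    rw [Finset.sum_comm]
    refine Finset.sum_congr rfl fun k hk => ?_
    rw [ih k hk, Finset.mul_sum]
    exact Finset.sum_congr rfl fun l _ => by ring

theorem walkSum_one (M : ι → ι → ℝ) {S : Finset ι} {j : ι} (hj : j ∈ S) (i : ι) :
    walkSum M S 1 i j = M i j := by
  simp [walkSum_succ, walkSum_zero, hj]

theorem walkSum_symm {M : ι → ι → ℝ} (hM : ∀ i j, M i j = M j i) (S : Finset ι) (n : ℕ) :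
    ∀ i ∈ S, ∀ j ∈ S, walkSum M S n i j = walkSum M S n j i := by
  induction n with
  | zero => intro i _ j _; simp [walkSum_zero, eq_comm]
  | succ n ih =>
    intro i hi j hj
    rw [walkSum_add M S n 1 i j hj, walkSum_succ]
    refine Finset.sum_congr rfl fun k hk => ?_
    rw [walkSum_one M hi, ih k hk j hj, hM i k, mul_comm]

/-- A walk starting away from `r` is cut at its first arrival at `r`, after `m + 1` steps; before
that it stays in `S.erase r`. -/
theorem walkSum_of_mem (M : ι → ι → ℝ) {S : Finset ι} {r : ι} (hr : r ∈ S) (n : ℕ) :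
    ∀ i ∈ S.erase r, walkSum M S (n + 1) i r = ∑ m ∈ Finset.range (n + 1),
      (∑ j ∈ S.erase r, walkSum M (S.erase r) m i j * M j r) * walkSum M S (n - m) r r := by
  induction n with
  | zero =>
    intro i hi
    rw [walkSum_one M hr]
    simp only [zero_add, Finset.range_one, Finset.sum_singleton, walkSum_zero, ite_mul, one_mul,
      zero_mul, Finset.sum_ite_eq, if_pos hi, Nat.sub_zero, if_true, mul_one]
  | succ n ih =>
    intro i hi
    rw [walkSum_succ, ← Finset.add_sum_erase S _ hr, Finset.sum_range_succ', add_comm]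
    congr 1
    · rw [Finset.sum_congr rfl fun k hk => by rw [ih k hk, Finset.mul_sum], Finset.sum_comm]
      refine Finset.sum_congr rfl fun m _ => ?_
      simp_rw [walkSum_succ, ← mul_assoc, Nat.add_sub_add_right, ← Finset.sum_mul,
        Finset.mul_sum, Finset.sum_mul]
      rw [Finset.sum_comm]
      simp only [mul_assoc]
    · simp only [walkSum_zero, ite_mul, one_mul, zero_mul, Finset.sum_ite_eq, if_pos hi,
        Nat.sub_zero]

/-- Either the first step is the loop at `r`, or the walk leaves `r` and first returns after `m + 2`
steps. Since `m < n`, the subtraction `n - 1 - m` is never truncated. -/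
theorem walkSum_succ_diag (M : ι → ι → ℝ) {S : Finset ι} {r : ι} (hr : r ∈ S) (n : ℕ) :
    walkSum M S (n + 1) r r = M r r * walkSum M S n r r +
      ∑ m ∈ Finset.range n, excursionSum M S r m * walkSum M S (n - 1 - m) r r := by
  rw [walkSum_succ, ← Finset.add_sum_erase S _ hr]
  congr 1
  cases n with
  | zero =>
    refine Finset.sum_eq_zero fun k hk => ?_
    rw [walkSum_zero, if_neg (Finset.ne_of_mem_erase hk), mul_zero]
  | succ n =>
    rw [Finset.sum_congr rfl fun k hk => by rw [walkSum_of_mem M hr n k hk, Finset.mul_sum],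
      Finset.sum_comm]
    refine Finset.sum_congr rfl fun m _ => ?_
    simp_rw [excursionSum, Nat.add_sub_cancel, Finset.sum_mul, Finset.mul_sum]
    simp only [mul_assoc]

/-- An excursion uses row `r` exactly once, in its first step. -/
theorem excursionSum_rowScale {M : ι → ι → ℝ} (S : Finset ι) (r : ι) (d : ℝ) (m : ℕ) :
    excursionSum (fun i j => (if i = r then d else 1) * M i j) S r m =
      d * excursionSum M S r m := by
  simp_rw [excursionSum, Finset.mul_sum]
  refine Finset.sum_congr rfl fun i hi => Finset.sum_congr rfl fun j hj => ?_
  rw [walkSum_congr (M' := M) _ m j i hi, if_neg (Finset.ne_of_mem_erase hj)]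
  · simp only [if_true]
    ring
  · intro k hk l _
    rw [if_neg (Finset.ne_of_mem_erase hk), one_mul]

/-- By symmetry, the excursion weight is the inner product of M_T^m u and M_T^n u, where u is row
`r` restricted to T = `S.erase r`. For `m = n` it is a sum of squares of linear forms in the row. -/
theorem excursionSum_add {M : ι → ι → ℝ} (hM : ∀ i j, M i j = M j i) (S : Finset ι) (r : ι)
    (m n : ℕ) : excursionSum M S r (m + n) = ∑ k ∈ S.erase r,
      (∑ j ∈ S.erase r, walkSum M (S.erase r) m k j * M r j) *
        ∑ j ∈ S.erase r, walkSum M (S.erase r) n k j * M r j := by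
  have h1 : ∀ i ∈ S.erase r, ∀ j ∈ S.erase r,
      M r i * walkSum M (S.erase r) (m + n) i j * M j r =
      ∑ k ∈ S.erase r, (walkSum M (S.erase r) m k i * M r i) *
        (walkSum M (S.erase r) n k j * M r j) := by
    intro i hi j hj
    rw [walkSum_add M _ m n j i hi, Finset.mul_sum, Finset.sum_mul]
    refine Finset.sum_congr rfl fun k hk => ?_
    rw [walkSum_symm hM _ m i hi k hk, hM j r]
    ring
  rw [excursionSum, Finset.sum_congr rfl fun i hi => Finset.sum_congr rfl (h1 i hi)]
  simp_rw [Finset.sum_mul_sum]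
  rw [Finset.sum_comm]
  rw [Finset.sum_congr rfl fun j _ => Finset.sum_comm, Finset.sum_comm]
  exact Finset.sum_congr rfl fun k _ => Finset.sum_comm

/-- The squared Frobenius norm of a symmetric matrix power is the trace of its square; this turns
variance bounds back into closed walks. -/
theorem sum_sq_walkSum {M : ι → ι → ℝ} (hM : ∀ i j, M i j = M j i) (S : Finset ι) (n : ℕ) :
    ∑ k ∈ S, ∑ j ∈ S, walkSum M S n k j ^ 2 = ∑ k ∈ S, walkSum M S (n + n) k k := by
  refine Finset.sum_congr rfl fun k hk => ?_
  rw [walkSum_add M S n n k k hk]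
  refine Finset.sum_congr rfl fun j hj => ?_
  rw [walkSum_symm hM S n j hj k hk, sq]

theorem matrix_pow_eq_walkSum (M : ℕ → ℕ → ℝ) (N n : ℕ) (a b : Fin N) :
    ((Matrix.of fun i j : Fin N => M i j) ^ n) a b = walkSum M (Finset.range N) n a b := by
  induction n generalizing a with
  | zero => simp [walkSum_zero, Matrix.one_apply, Fin.ext_iff]
  | succ n ih =>
    rw [pow_succ', Matrix.mul_apply, walkSum_succ, Finset.sum_range]
    exact Finset.sum_congr rfl fun k _ => by rw [ih]; rfl

end WalkSum

/-! ### Dyck paths and the recurrence for the limit. -/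

section Dyck

open DyckStep

theorem dyckXi_zero : dyckXi 0 = 0 := rfl

theorem dyckXi_add (p q : DyckWord) : dyckXi (p + q) = dyckXi p + dyckXi q := by
  have hl : (p + q).toList = p.toList ++ q.toList := rfl
  have hr : Finset.range (p + q).toList.length = Finset.range p.toList.length ∪
      (Finset.range q.toList.length).map (addLeftEmbedding p.toList.length) := by
    rw [hl, List.length_append, Finset.range_add_eq_union]
  rw [dyckXi, hr, Finset.filter_union, Finset.card_union_of_disjoint]
  · congr 1
    · rw [dyckXi]
      congr 1
      refine Finset.filter_congr fun i hi => ?_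
      rw [Finset.mem_range] at hi
      rw [hl, List.take_append_of_le_length hi.le]
    · rw [Finset.filter_map, Finset.card_map, dyckXi]
      congr 1
      refine Finset.filter_congr fun i _ => ?_
      have := p.count_U_eq_count_D
      simp only [Function.comp_apply, addLeftEmbedding_apply, hl]
      rw [List.take_append, List.take_of_length_le (by omega), List.count_append,
        List.count_append, Nat.add_sub_cancel_left]
      omega
  · rw [Finset.disjoint_left]
    intro i h1 h2
    simp only [Finset.mem_filter, Finset.mem_range, Finset.mem_map, addLeftEmbedding_apply]
      at h1 h2
    obtain ⟨⟨a, _, rfl⟩, _⟩ := h2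
    omega

/-- A nested path is strictly above the axis between its endpoints, and the final point is not
counted. -/
theorem dyckXi_nest (p : DyckWord) : dyckXi p.nest = 1 := by
  have h := DyckWord.IsNested.nest (p := p)
  rw [dyckXi, Finset.card_eq_one]
  refine ⟨0, ?_⟩
  ext i
  simp only [Finset.mem_filter, Finset.mem_range, Finset.mem_singleton]
  constructor
  · rintro ⟨h1, h2⟩
    by_contra hi
    exact absurd h2 (h.2 (Nat.pos_of_ne_zero hi) h1).ne'
  · rintro rfl
    exact ⟨by simp [DyckWord.nest], by simp⟩

theorem semilength_add_nest (a b : DyckWord) :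
    (a.nest + b).semilength = a.semilength + b.semilength + 1 := by
  simp [DyckWord.semilength_add, DyckWord.semilength_nest]
  ring

/-- The decomposition of a nonempty Dyck path at its first return to the axis. -/
def firstReturnEquiv (m : ℕ) : {w : DyckWord // w.semilength = m + 1} ≃
    Σ ab : {ab // ab ∈ Finset.HasAntidiagonal.antidiagonal m},
      {w : DyckWord // w.semilength = ab.1.1} × {w : DyckWord // w.semilength = ab.1.2} where
  toFun w := ⟨⟨(w.1.insidePart.semilength, w.1.outsidePart.semilength), by
    have h0 : w.1 ≠ 0 := fun h => by
      have := w.2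
      rw [h] at this
      simp at this
    have := DyckWord.semilength_insidePart_add_semilength_outsidePart_add_one h0
    rw [w.2] at this
    rw [Finset.HasAntidiagonal.mem_antidiagonal]
    omega⟩, ⟨⟨w.1.insidePart, rfl⟩, ⟨w.1.outsidePart, rfl⟩⟩⟩
  invFun t := ⟨t.2.1.1.nest + t.2.2.1, by
    rw [semilength_add_nest, t.2.1.2, t.2.2.2, Finset.HasAntidiagonal.mem_antidiagonal.1 t.1.2]⟩
  left_inv w := by
    have h0 : w.1 ≠ 0 := fun h => by
      have := w.2
      rw [h] at this
      simp at this
    exact Subtype.ext (DyckWord.nest_insidePart_add_outsidePart h0)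
  right_inv t := by
    obtain ⟨⟨⟨a, b⟩, h⟩, ⟨⟨w, hw⟩, ⟨v, hv⟩⟩⟩ := t
    dsimp only at hw hv
    subst hw hv
    have h1 : (w.nest + v).insidePart = w := by
      rw [DyckWord.insidePart_add (by simp), DyckWord.insidePart_nest]
    have h2 : (w.nest + v).outsidePart = v := by
      rw [DyckWord.outsidePart_add (by simp), DyckWord.outsidePart_nest, zero_add]
    simp only [h1, h2]
    congr!

theorem dyckPi_zero (d : ℝ) : dyckPi d 0 = 1 := by
  have h : ∀ w : {w : DyckWord // w.semilength = 0}, w = ⟨0, rfl⟩ := fun w =>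
    Subtype.ext (DyckWord.toList_eq_nil.1 (List.eq_nil_of_length_eq_zero (by
      rw [← w.1.two_mul_semilength_eq_length, w.2])))
  rw [dyckPi, Fintype.sum_eq_single ⟨0, rfl⟩ fun w hw => absurd (h w) hw]
  simp [dyckXi_zero]

/-- For w = `a.nest + b`, ξ(w) = 1 + ξ(b): the inner path a is lifted off the axis and counts with
weight 1, whence the factor `dyckPi 1`. -/
theorem dyckPi_succ (d : ℝ) (m : ℕ) :
    dyckPi d (m + 1) =
      d * ∑ ab ∈ Finset.HasAntidiagonal.antidiagonal m, dyckPi 1 ab.1 * dyckPi d ab.2 := by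
  rw [← Finset.sum_coe_sort, Finset.mul_sum, dyckPi, ← (firstReturnEquiv m).symm.sum_comp,
    Fintype.sum_sigma]
  refine Finset.sum_congr rfl fun ab _ => ?_
  rw [Fintype.sum_prod_type, dyckPi, dyckPi, Finset.sum_mul_sum, Finset.mul_sum]
  refine Finset.sum_congr rfl fun a _ => ?_
  rw [Finset.mul_sum]
  refine Finset.sum_congr rfl fun b _ => ?_
  simp only [firstReturnEquiv, Equiv.coe_fn_symm_mk, dyckXi_add, dyckXi_nest, one_pow, pow_add]
  ring

/-- The limit of the `n`-th moment. -/
noncomputable def limitMoment (d : ℝ) (n : ℕ) : ℝ := if Even n then dyckPi d (n / 2) else 0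

theorem limitMoment_zero (d : ℝ) : limitMoment d 0 = 1 := by simp [limitMoment, dyckPi_zero]

/-- The Dyck recurrence indexed by length, odd lengths contributing zero, so that it has exactly the
shape of `walkSum_succ_diag` without the diagonal term. -/
theorem limitMoment_succ (d : ℝ) (n : ℕ) : limitMoment d (n + 1) =
    d * ∑ m ∈ Finset.range n, limitMoment 1 m * limitMoment d (n - 1 - m) := by
  rcases Nat.even_or_odd' n with ⟨k, rfl | rfl⟩
  · have : ¬ Even (2 * k + 1) := by simp
    rw [limitMoment, if_neg this, Finset.sum_eq_zero, mul_zero]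
    intro m hm
    rw [Finset.mem_range] at hm
    by_cases h : Even m
    · have : ¬ Even (2 * k - 1 - m) := by
        rw [Nat.not_even_iff_odd]
        obtain ⟨a, rfl⟩ := h
        exact ⟨k - 1 - a, by omega⟩
      rw [limitMoment, limitMoment, if_neg this, mul_zero]
    · rw [limitMoment, if_neg h, zero_mul]
  · have h1 : Even (2 * k + 1 + 1) := ⟨k + 1, by ring⟩
    rw [limitMoment, if_pos h1, show (2 * k + 1 + 1) / 2 = k + 1 by omega, dyckPi_succ,
      Finset.Nat.sum_antidiagonal_eq_sum_range_succ (fun a b => dyckPi 1 a * dyckPi d b)]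
    congr 1
    -- Only even indices survive in the sum over lengths, which matches it with the antidiagonal sum
    -- over orders.
    have hs : ∀ f : ℕ → ℝ, (∀ a, f (2 * a + 1) = 0) → ∀ k,
        ∑ m ∈ Finset.range (2 * k + 1), f m = ∑ a ∈ Finset.range (k + 1), f (2 * a) := by
      intro f hf k
      induction k with
      | zero => simp
      | succ k ih =>
        rw [show 2 * (k + 1) + 1 = 2 * k + 1 + 1 + 1 by ring, Finset.sum_range_succ,
          Finset.sum_range_succ, ih, hf, Finset.sum_range_succ _ (k + 1)]
        ring_nf
    rw [hs]
    · refine Finset.sum_congr rfl fun a ha => ?_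
      rw [Finset.mem_range] at ha
      have h2 : Even (2 * k + 1 - 1 - 2 * a) := ⟨k - a, by omega⟩
      rw [limitMoment, limitMoment, if_pos (even_two_mul a), if_pos h2,
        show 2 * a / 2 = a by omega, show (2 * k + 1 - 1 - 2 * a) / 2 = k - a by omega]
    · intro a
      have : ¬ Even (2 * a + 1) := by simp
      rw [limitMoment, if_neg this, zero_mul]

end Dyck

/-! ### Finite moments and a Rosenthal-type inequality. -/

section Moments

open scoped ENNReal NNReal

variable {Ω : Type*} [MeasurableSpace Ω] {P : Measure Ω}

instance holderTriple_two_mul (p : ℕ) :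
    ENNReal.HolderTriple ((2 * p : ℕ) : ℝ≥0∞) ((2 * p : ℕ) : ℝ≥0∞) (p : ℝ≥0∞) where
  inv_add_inv_eq_inv := by
    rw [Nat.cast_mul, Nat.cast_ofNat, ENNReal.mul_inv (by simp) (by simp), ← add_mul,
      ENNReal.inv_two_add_inv_two, one_mul]

/-- The random variable `f` has finite absolute moments of all orders. -/
def HasAllMoments (f : Ω → ℝ) (P : Measure Ω) : Prop := ∀ p : ℕ, MemLp f p P

namespace HasAllMoments

variable {f g : Ω → ℝ}

theorem const [IsFiniteMeasure P] (c : ℝ) : HasAllMoments (fun _ : Ω => c) P :=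
  fun _ => memLp_const c

theorem add (hf : HasAllMoments f P) (hg : HasAllMoments g P) :
    HasAllMoments (fun ω => f ω + g ω) P := fun p => (hf p).add (hg p)

theorem sub (hf : HasAllMoments f P) (hg : HasAllMoments g P) :
    HasAllMoments (fun ω => f ω - g ω) P := fun p => (hf p).sub (hg p)

theorem mul (hf : HasAllMoments f P) (hg : HasAllMoments g P) :
    HasAllMoments (fun ω => f ω * g ω) P := fun p => (hg (2 * p)).mul (hf (2 * p))

theorem pow [IsFiniteMeasure P] (hf : HasAllMoments f P) (n : ℕ) :
    HasAllMoments (fun ω => f ω ^ n) P := by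
  induction n with
  | zero => simpa using const 1
  | succ n ih => simpa only [pow_succ] using ih.mul hf

theorem sum {ι : Type*} {F : ι → Ω → ℝ} {S : Finset ι} (h : ∀ i ∈ S, HasAllMoments (F i) P) :
    HasAllMoments (fun ω => ∑ i ∈ S, F i ω) P := fun p => memLp_finsetSum S fun i hi => h i hi p

theorem integrable (hf : HasAllMoments f P) : Integrable f P := by
  simpa [memLp_one_iff_integrable] using hf 1

end HasAllMoments

theorem pow_mul_le_pow_add_pow {u w : ℝ} (hu : 0 ≤ u) (hw : 0 ≤ w) (q : ℕ) :
    u ^ q * w ≤ u ^ (q + 1) + w ^ (q + 1) := by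
  rcases le_total u w with h | h
  · have := mul_le_mul_of_nonneg_right (pow_le_pow_left₀ hu h q) hw
    have := pow_nonneg hu (q + 1)
    rw [pow_succ w]
    linarith
  · have := mul_le_mul_of_nonneg_left h (pow_nonneg hu q)
    have := pow_nonneg hw (q + 1)
    rw [pow_succ u]
    linarith

/-- The term linear in `y` is kept exact, since it integrates to zero when `y` is centred and
independent of `t`; all later terms are absorbed in the two extremes. -/
theorem exists_add_pow_le (q : ℕ) : ∃ K : ℝ, 0 ≤ K ∧ ∀ t y : ℝ, (t + y) ^ (2 * (q + 1)) ≤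
    t ^ (2 * (q + 1)) + (2 * q + 2) * (t ^ (2 * q + 1) * y) +
      K * (y ^ 2 * t ^ (2 * q) + y ^ (2 * (q + 1))) := by
  induction q with
  | zero =>
    refine ⟨1, zero_le_one, fun t y => ?_⟩
    simp only [Nat.cast_zero, mul_zero, zero_add, pow_one, mul_one, pow_zero]
    nlinarith [sq_nonneg y]
  | succ q ih =>
    obtain ⟨K, hK, h⟩ := ih
    -- Expanding (t + y)² times the previous bound leaves six error monomials. Each summand is the
    -- coefficient of one of them times the factor, 1 or 2, with which that monomial is bounded by
    -- `Z` below.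
    refine ⟨1 + 2 * (2 * q + 2) + K + 2 * ((2 * q + 2) + 2 * K) + K + 4 * K + K + K, by positivity,
      fun t y => ?_⟩
    have h1 := mul_le_mul_of_nonneg_left (h t y) (sq_nonneg (t + y))
    have e1 := pow_mul_le_pow_add_pow (sq_nonneg t) (sq_nonneg y) q
    have e2 := pow_mul_le_pow_add_pow (sq_nonneg y) (sq_nonneg t) q
    simp only [← pow_mul] at e1 e2
    have hq : (0 : ℝ) ≤ q := Nat.cast_nonneg q
    set A := t ^ (2 * q) with hA
    set Y := y ^ (2 * q) with hY
    have hA0 : 0 ≤ A := by rw [hA, pow_mul]; positivity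
    have hY0 : 0 ≤ Y := by rw [hY, pow_mul]; positivity
    have a1 : t ^ (2 * (q + 1)) = A * t ^ 2 := by rw [hA]; ring
    have a2 : t ^ (2 * q + 1) = A * t := by rw [hA]; ring
    have a3 : y ^ (2 * (q + 1)) = Y * y ^ 2 := by rw [hY]; ring
    have a4 : t ^ (2 * (q + 1 + 1)) = A * t ^ 4 := by rw [hA]; ring
    have a5 : y ^ (2 * (q + 1 + 1)) = Y * y ^ 4 := by rw [hY]; ring
    have a6 : t ^ (2 * (q + 1) + 1) = A * t ^ 3 := by rw [hA]; ring
    have a7 : (t + y) ^ (2 * (q + 1 + 1)) = (t + y) ^ 2 * (t + y) ^ (2 * (q + 1)) := by ring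
    rw [a1, a3] at e1 e2
    rw [a1, a2, a3] at h1
    rw [a4, a5, a6, a7, a1]
    push_cast
    refine h1.trans ?_
    have e3 : A * y ^ 4 ≤ A * t ^ 2 * y ^ 2 + Y * y ^ 4 := by
      nlinarith [mul_le_mul_of_nonneg_right e1 (sq_nonneg y)]
    have e4 : Y * y ^ 2 * t ^ 2 ≤ A * t ^ 2 * y ^ 2 + Y * y ^ 4 := by
      nlinarith [mul_le_mul_of_nonneg_right e2 (sq_nonneg y)]
    have e5 : A * (t * y ^ 3) ≤ A * t ^ 2 * y ^ 2 + A * y ^ 4 := by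
      have : t * y ^ 3 ≤ t ^ 2 * y ^ 2 + y ^ 4 := by
        nlinarith [mul_nonneg (sq_nonneg y) (sq_nonneg (t - y)),
          mul_nonneg (sq_nonneg y) (sq_nonneg t), mul_nonneg (sq_nonneg y) (sq_nonneg y)]
      nlinarith [mul_le_mul_of_nonneg_left this hA0]
    have e6 : Y * (t * y ^ 3) ≤ Y * y ^ 2 * t ^ 2 + Y * y ^ 4 := by
      have : t * y ^ 3 ≤ y ^ 2 * t ^ 2 + y ^ 4 := by
        nlinarith [mul_nonneg (sq_nonneg y) (sq_nonneg (t - y)),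
          mul_nonneg (sq_nonneg y) (sq_nonneg t), mul_nonneg (sq_nonneg y) (sq_nonneg y)]
      nlinarith [mul_le_mul_of_nonneg_left this hY0]
    set Z := A * t ^ 2 * y ^ 2 + Y * y ^ 4 with hZ
    have b0 : 0 ≤ A * t ^ 2 * y ^ 2 := by positivity
    have b1 : 0 ≤ Y * y ^ 4 := by positivity
    have b2 : A * (t * y ^ 3) ≤ 2 * Z := by linarith
    have b3 : Y * (t * y ^ 3) ≤ 2 * Z := by linarith
    have b4 : A * t ^ 2 * y ^ 2 ≤ Z := by linarith
    have b5 : Y * y ^ 4 ≤ Z := by linarith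
    have c1 := mul_le_mul_of_nonneg_left b4 (by positivity : 0 ≤ 1 + 2 * (2 * (q : ℝ) + 2) + K)
    have c2 := mul_le_mul_of_nonneg_left b2 (by positivity : 0 ≤ (2 * (q : ℝ) + 2) + 2 * K)
    have c3 := mul_le_mul_of_nonneg_left e3 hK
    have c4 := mul_le_mul_of_nonneg_left b3 hK
    have c5 := mul_le_mul_of_nonneg_left e4 hK
    have c6 := mul_le_mul_of_nonneg_left b5 hK
    linear_combination c1 + c2 + c3 + 2 * c4 + c5 + c6

/-- Induction on `q`, then on `S`, adding one independent summand at a time: the linear term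
vanishes and the quadratic one factorizes. The constant is chosen before `Y`, `b` and `S`, so that
the bound can be used with coefficients frozen by conditioning. -/
theorem exists_integral_sum_pow_le [IsProbabilityMeasure P] {ι : Type*} [DecidableEq ι]
    (B : ℕ → ℝ) (hB : ∀ p, 0 ≤ B p) (q : ℕ) : ∃ C : ℝ, 0 ≤ C ∧ ∀ (Y : ι → Ω → ℝ) (b : ι → ℝ), iIndepFun Y P →
      (∀ j, Measurable (Y j)) → (∀ j, 0 ≤ b j) → ∀ S : Finset ι,
      (∀ j ∈ S, HasAllMoments (Y j) P) → (∀ j ∈ S, ∫ ω, Y j ω ∂P = 0) →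
      (∀ j ∈ S, ∀ p, ∫ ω, Y j ω ^ (2 * p) ∂P ≤ B p * b j ^ p) →
      ∫ ω, (∑ j ∈ S, Y j ω) ^ (2 * q) ∂P ≤ C * (∑ j ∈ S, b j) ^ q := by
  induction q with
  | zero => exact ⟨1, zero_le_one, fun Y b _ _ _ S _ _ _ => by simp⟩
  | succ q ih =>
    obtain ⟨C₀, hC₀, h₀⟩ := ih
    obtain ⟨K, hK, hpt⟩ := exists_add_pow_le q
    -- The factor 2 pays for two increments of (∑ b)^(q+1): `k4` absorbs b_m σ^q and `k5` absorbs
    -- b_m^(q+1).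
    refine ⟨2 * (K * (B 1 * C₀ + B (q + 1))), by have := hB 1; have := hB (q + 1); positivity,
      fun Y b hY hYm hb S => ?_⟩
    induction S using Finset.induction_on with
    | empty => intro _ _ _; simp
    | insert m S hm ihS =>
      intro hmom hmean hbd
      have hmomS : ∀ j ∈ S, HasAllMoments (Y j) P := fun j hj =>
        hmom j (Finset.mem_insert_of_mem hj)
      have ih1 := ihS hmomS (fun j hj => hmean j (Finset.mem_insert_of_mem hj))
        (fun j hj => hbd j (Finset.mem_insert_of_mem hj))
      have ih0 := h₀ Y b hY hYm hb S hmomS (fun j hj => hmean j (Finset.mem_insert_of_mem hj))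
        (fun j hj => hbd j (Finset.mem_insert_of_mem hj))
      set T : Ω → ℝ := fun ω => ∑ j ∈ S, Y j ω with hT
      have hTm : HasAllMoments T P := HasAllMoments.sum hmomS
      have hYm' := hmom m (Finset.mem_insert_self m S)
      have hmeanm := hmean m (Finset.mem_insert_self m S)
      have hbdm := hbd m (Finset.mem_insert_self m S)
      have hind : IndepFun T (Y m) P := by
        have := hY.indepFun_finsetSum_of_notMem hYm hm
        rwa [show (∑ j ∈ S, Y j) = T from by ext ω; simp [hT]] at this
      have hTmeas : Measurable T := Finset.measurable_sum S fun j _ => hYm j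
      have i1 : ∫ ω, T ω ^ (2 * q + 1) * Y m ω ∂P = 0 := by
        have := (hind.comp (measurable_id.pow_const (2 * q + 1)) measurable_id)
          |>.integral_mul_eq_mul_integral
            (hTmeas.pow_const (2 * q + 1)).aestronglyMeasurable (hYm m).aestronglyMeasurable
        simp only [Function.comp_def, Pi.mul_def, id] at this
        rw [this, hmeanm, mul_zero]
      have i2 : ∫ ω, Y m ω ^ 2 * T ω ^ (2 * q) ∂P =
          (∫ ω, Y m ω ^ 2 ∂P) * ∫ ω, T ω ^ (2 * q) ∂P := by
        have := (hind.symm.comp (measurable_id.pow_const 2) (measurable_id.pow_const (2 * q)))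
          |>.integral_mul_eq_mul_integral
            ((hYm m).pow_const 2).aestronglyMeasurable
            (hTmeas.pow_const (2 * q)).aestronglyMeasurable
        simpa only [Function.comp_def, Pi.mul_def, id] using this
      have hle : ∫ ω, (T ω + Y m ω) ^ (2 * (q + 1)) ∂P ≤ ∫ ω, T ω ^ (2 * (q + 1)) ∂P +
          (2 * q + 2) * ∫ ω, T ω ^ (2 * q + 1) * Y m ω ∂P +
          K * (∫ ω, Y m ω ^ 2 * T ω ^ (2 * q) ∂P + ∫ ω, Y m ω ^ (2 * (q + 1)) ∂P) := by
        have j1 := (hTm.pow (2 * (q + 1))).integrable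
        have j2 := ((hTm.pow (2 * q + 1)).mul hYm').integrable
        have j3 := ((hYm'.pow 2).mul (hTm.pow (2 * q))).integrable
        have j4 := (hYm'.pow (2 * (q + 1))).integrable
        have e : ∫ ω, (T ω ^ (2 * (q + 1)) + (2 * q + 2) * (T ω ^ (2 * q + 1) * Y m ω) +
            K * (Y m ω ^ 2 * T ω ^ (2 * q) + Y m ω ^ (2 * (q + 1)))) ∂P =
            ∫ ω, T ω ^ (2 * (q + 1)) ∂P +
            (2 * q + 2) * ∫ ω, T ω ^ (2 * q + 1) * Y m ω ∂P +
            K * (∫ ω, Y m ω ^ 2 * T ω ^ (2 * q) ∂P + ∫ ω, Y m ω ^ (2 * (q + 1)) ∂P) := by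
          rw [integral_add, integral_add, integral_const_mul, integral_const_mul, integral_add]
          exacts [j3, j4, j1, j2.const_mul _, j1.add (j2.const_mul _), (j3.add j4).const_mul _]
        rw [← e]
        exact integral_mono ((hTm.add hYm').pow _).integrable
          ((j1.add (j2.const_mul _)).add ((j3.add j4).const_mul _)) fun ω => hpt (T ω) (Y m ω)
      have hs : ∀ ω, ∑ j ∈ insert m S, Y j ω = T ω + Y m ω := fun ω => by
        rw [Finset.sum_insert hm, add_comm]
      simp_rw [hs]
      rw [Finset.sum_insert hm]
      rw [i1, i2, mul_zero, add_zero] at hle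
      refine hle.trans ?_
      set σ := ∑ j ∈ S, b j
      have hσ : 0 ≤ σ := Finset.sum_nonneg fun j _ => hb j
      have hbm := hb m
      have k1 := hbdm 1
      have k2 := hbdm (q + 1)
      rw [mul_one, pow_one] at k1
      have k3 : (∫ ω, Y m ω ^ 2 ∂P) * ∫ ω, T ω ^ (2 * q) ∂P ≤ (B 1 * b m) * (C₀ * σ ^ q) :=
        mul_le_mul k1 ih0 (integral_nonneg fun ω => (even_two_mul q).pow_nonneg _)
          (mul_nonneg (hB 1) hbm)
      have k4 : σ ^ (q + 1) + b m * σ ^ q ≤ (b m + σ) ^ (q + 1) := by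
        rw [pow_succ' (b m + σ), pow_succ' σ]
        have := pow_le_pow_left₀ hσ (by linarith : σ ≤ b m + σ) q
        nlinarith [mul_le_mul_of_nonneg_left this (add_nonneg hbm hσ)]
      have k5 : σ ^ (q + 1) + b m ^ (q + 1) ≤ (b m + σ) ^ (q + 1) := by
        rw [add_comm (b m)]
        exact pow_add_pow_le hσ hbm (Nat.succ_ne_zero q)
      have l1 := hB 1
      have l2 := hB (q + 1)
      have m1 : 0 ≤ σ ^ q := by positivity
      have m2 : 0 ≤ b m ^ (q + 1) := by positivity
      have k6 := mul_le_mul_of_nonneg_left k4 (by positivity : 0 ≤ K * (B 1 * C₀ + B (q + 1)))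
      have k7 := mul_le_mul_of_nonneg_left k5 (by positivity : 0 ≤ K * (B 1 * C₀ + B (q + 1)))
      have k8 := mul_le_mul_of_nonneg_left (add_le_add k3 k2) hK
      have k9 : 0 ≤ K * B (q + 1) * (b m * σ ^ q) := by positivity
      have k10 : 0 ≤ K * (B 1 * C₀) * b m ^ (q + 1) := by positivity
      linear_combination ih1 + k6 + k7 + k8 + k9 + k10

end Moments

/-! ### Conditioning on an independent variable; linear and quadratic forms. -/

section Independence

open scoped ENNReal NNReal

theorem measurable_iSup_comap {Ω ι : Type*} (X : ι → Ω → ℝ) {S : Set ι} {j : ι} (hj : j ∈ S) :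
    Measurable[⨆ i ∈ S, MeasurableSpace.comap (X i) inferInstance] (X j) :=
  (comap_measurable (X j)).mono
    (le_iSup₂ (f := fun i (_ : i ∈ S) => MeasurableSpace.comap (X i) inferInstance) j hj) le_rfl

variable {Ω : Type*} [MeasurableSpace Ω] {P : Measure Ω}

theorem iIndepFun.indepFun_of_measurable_iSup {ι : Type*} {X : ι → Ω → ℝ} (hX : iIndepFun X P)
    (hXm : ∀ j, Measurable (X j)) {S T : Set ι} (hST : Disjoint S T) {α β : Type*}
    [MeasurableSpace α] [MeasurableSpace β] {f : Ω → α} {g : Ω → β}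
    (hf : Measurable[⨆ i ∈ S, MeasurableSpace.comap (X i) inferInstance] f)
    (hg : Measurable[⨆ i ∈ T, MeasurableSpace.comap (X i) inferInstance] g) :
    IndepFun f g P := by
  have h := indep_iSup_of_disjoint (fun i => (hXm i).comap_le) hX hST
  exact indep_of_indep_of_le_left (indep_of_indep_of_le_right h hg.comap_le) hf.comap_le

theorem IndepFun.lintegral_prod_eq [IsProbabilityMeasure P] {α β : Type*} [MeasurableSpace α]
    [MeasurableSpace β] {A : Ω → α} {V : Ω → β} (h : IndepFun A V P) (hA : Measurable A)
    (hV : Measurable V) {F : α × β → ℝ≥0∞} (hF : Measurable F) :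
    ∫⁻ ω, F (A ω, V ω) ∂P = ∫⁻ ω, ∫⁻ ω', F (A ω, V ω') ∂P ∂P := by
  have h1 := (indepFun_iff_map_prod_eq_prod_map_map hA.aemeasurable hV.aemeasurable).1 h
  have := Measure.isProbabilityMeasure_map hV.aemeasurable (μ := P)
  have := Measure.isProbabilityMeasure_map hA.aemeasurable (μ := P)
  rw [← lintegral_map hF (hA.prodMk hV), h1, lintegral_prod _ hF.aemeasurable,
    lintegral_map hF.lintegral_prod_right' hA]
  refine lintegral_congr fun ω => ?_
  exact lintegral_map (hF.comp measurable_prodMk_left) hV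

theorem eLpNorm_pow_eq_lintegral (f : Ω → ℝ) {p : ℕ} (hp : p ≠ 0) :
    eLpNorm f p P ^ p = ∫⁻ ω, ‖f ω‖ₑ ^ p ∂P := by
  rw [eLpNorm_eq_lintegral_rpow_enorm_toReal (by exact_mod_cast hp) (by simp)]
  simp only [ENNReal.toReal_natCast, ENNReal.rpow_natCast, one_div]
  rw [← ENNReal.rpow_natCast, ← ENNReal.rpow_mul, inv_mul_cancel₀ (by exact_mod_cast hp),
    ENNReal.rpow_one]

/-- By Fubini, a bound valid for each frozen value of `A` integrates to an unconditional one. -/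
theorem IndepFun.eLpNorm_le [IsProbabilityMeasure P] {α β : Type*} [MeasurableSpace α]
    [MeasurableSpace β] {A : Ω → α} {V : Ω → β} (h : IndepFun A V P) (hA : Measurable A)
    (hV : Measurable V) {F : α × β → ℝ} (hF : Measurable F) (G : α → ℝ) {p : ℕ} (hp : p ≠ 0)
    (hFG : ∀ ω', eLpNorm (fun ω => F (A ω', V ω)) p P ≤ ‖G (A ω')‖ₑ) :
    eLpNorm (fun ω => F (A ω, V ω)) p P ≤ eLpNorm (fun ω => G (A ω)) p P := by
  rw [← ENNReal.pow_le_pow_left_iff hp, eLpNorm_pow_eq_lintegral _ hp,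
    eLpNorm_pow_eq_lintegral _ hp,
    IndepFun.lintegral_prod_eq h hA hV (F := fun z => ‖F z‖ₑ ^ p) (by fun_prop)]
  refine lintegral_mono fun ω => ?_
  rw [← eLpNorm_pow_eq_lintegral _ hp]
  exact pow_le_pow_left₀ zero_le (hFG _) p

theorem eLpNorm_pow_two_mul_le {f : Ω → ℝ} (hf : HasAllMoments f P) {c : ℝ} (hc : 0 ≤ c) {q : ℕ}
    (hq : q ≠ 0) (h : ∫ ω, f ω ^ (2 * q) ∂P ≤ c ^ q) [IsFiniteMeasure P] :
    eLpNorm (fun ω => f ω ^ 2) q P ≤ ENNReal.ofReal c := by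
  rw [← ENNReal.pow_le_pow_left_iff hq, eLpNorm_pow_eq_lintegral _ hq, ← ENNReal.ofReal_pow hc]
  refine le_trans (le_of_eq ?_) (ENNReal.ofReal_le_ofReal h)
  rw [ofReal_integral_eq_lintegral_ofReal (hf.pow _).integrable
    (ae_of_all _ fun ω => (even_two_mul q).pow_nonneg _)]
  refine lintegral_congr fun ω => ?_
  rw [← enorm_pow, ← pow_mul, Real.enorm_of_nonneg ((even_two_mul q).pow_nonneg _)]

/-- The moment inequality bounds each linear form, and Minkowski's inequality sums over `k`. -/
theorem exists_eLpNorm_sum_sq_le [IsProbabilityMeasure P] {ι κ : Type*} [DecidableEq ι]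
    (B : ℕ → ℝ) (hB : ∀ p, 0 ≤ B p) {p : ℕ} (hp : p ≠ 0) :
    ∃ C : ℝ, 0 ≤ C ∧ ∀ (X : ι → Ω → ℝ), iIndepFun X P → (∀ j, Measurable (X j)) →
      ∀ (T : Finset κ) (S : Finset ι) (a : κ → ι → ℝ), (∀ j ∈ S, HasAllMoments (X j) P) →
      (∀ j ∈ S, ∫ ω, X j ω ∂P = 0) → (∀ j ∈ S, ∀ q, ∫ ω, X j ω ^ (2 * q) ∂P ≤ B q) →
      eLpNorm (fun ω => ∑ k ∈ T, (∑ j ∈ S, a k j * X j ω) ^ 2) p P ≤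
        ENNReal.ofReal (C * ∑ k ∈ T, ∑ j ∈ S, a k j ^ 2) := by
  obtain ⟨C, hC, h⟩ := exists_integral_sum_pow_le (P := P) (ι := ι) B hB p
  refine ⟨C + 1, by positivity, fun X hX hXm T S a hmom hmean hbd => ?_⟩
  have hm : ∀ k, ∀ j ∈ S, HasAllMoments (fun ω => a k j * X j ω) P := fun k j hj =>
    (HasAllMoments.const _).mul (hmom j hj)
  have key : ∀ k, eLpNorm (fun ω => (∑ j ∈ S, a k j * X j ω) ^ 2) p P ≤
      ENNReal.ofReal ((C + 1) * ∑ j ∈ S, a k j ^ 2) := by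
    intro k
    have hs : 0 ≤ ∑ j ∈ S, a k j ^ 2 := Finset.sum_nonneg fun j _ => sq_nonneg _
    refine eLpNorm_pow_two_mul_le (HasAllMoments.sum (hm k)) (by positivity) hp ?_
    refine (h (fun j ω => a k j * X j ω) (fun j => a k j ^ 2)
      (hX.comp (fun j x => a k j * x) fun j => measurable_const_mul _)
      (fun j => (hXm j).const_mul _) (fun j => sq_nonneg _) S (hm k) ?_ ?_).trans ?_
    · intro j hj
      rw [integral_const_mul, hmean j hj, mul_zero]
    · intro j hj q
      simp_rw [mul_pow]
      rw [integral_const_mul, ← pow_mul, mul_comm]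
      exact mul_le_mul_of_nonneg_right (hbd j hj q) ((even_two_mul q).pow_nonneg _)
    · rw [mul_pow]
      refine mul_le_mul_of_nonneg_right ?_ (by positivity)
      calc C ≤ C + 1 := by linarith
        _ ≤ (C + 1) ^ p := le_self_pow₀ (by linarith) hp
  have h1 : eLpNorm (∑ k ∈ T, fun ω => (∑ j ∈ S, a k j * X j ω) ^ 2) p P ≤
      ∑ k ∈ T, eLpNorm (fun ω => (∑ j ∈ S, a k j * X j ω) ^ 2) p P :=
    eLpNorm_sum_le (fun k _ => (((HasAllMoments.sum (hm k)).pow 2) 1).1)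
      (by exact_mod_cast Nat.one_le_iff_ne_zero.2 hp)
  rw [show (fun ω => ∑ k ∈ T, (∑ j ∈ S, a k j * X j ω) ^ 2) =
    ∑ k ∈ T, fun ω => (∑ j ∈ S, a k j * X j ω) ^ 2 by ext ω; simp]
  refine h1.trans ((Finset.sum_le_sum fun k _ => key k).trans (le_of_eq ?_))
  rw [← ENNReal.ofReal_sum_of_nonneg, Finset.mul_sum]
  intro k _
  have hs : 0 ≤ ∑ j ∈ S, a k j ^ 2 := Finset.sum_nonneg fun j _ => sq_nonneg _
  positivity

/-- Martingale argument: adding the index m changes the centred form by L X_m + b_mm (X_m² - 1),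
which is orthogonal to the earlier form because X_m is independent of it with mean 0 and variance 1.
-/
theorem exists_integral_quadratic_form_sub_trace_sq_le [IsProbabilityMeasure P] {ι : Type*}
    [DecidableEq ι] (B : ℕ → ℝ) (hB : ∀ p, 0 ≤ B p) :
    ∃ C : ℝ, 0 ≤ C ∧ ∀ (X : ι → Ω → ℝ), iIndepFun X P → (∀ j, Measurable (X j)) →
      ∀ (b : ι → ι → ℝ), ∀ S : Finset ι, (∀ i ∈ S, ∀ j ∈ S, b i j = b j i) →
      (∀ j ∈ S, HasAllMoments (X j) P) →
      (∀ j ∈ S, ∫ ω, X j ω ∂P = 0) → (∀ j ∈ S, ∫ ω, X j ω ^ 2 ∂P = 1) →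
      (∀ j ∈ S, ∀ q, ∫ ω, X j ω ^ (2 * q) ∂P ≤ B q) →
      ∫ ω, (∑ i ∈ S, ∑ j ∈ S, b i j * (X i ω * X j ω) - ∑ i ∈ S, b i i) ^ 2 ∂P ≤
        C * ∑ i ∈ S, ∑ j ∈ S, b i j ^ 2 := by
  obtain ⟨C, hC, h⟩ := exists_integral_sum_pow_le (P := P) (ι := ι) B hB 1
  have hB1 := hB 1
  have hB2 := hB 2
  -- Splitting the square of the increment costs a factor 2, and E L² ≤ 4C ∑ b_mj². Each
  -- off-diagonal b_mj² occurs twice on the right, so 8C becomes 4C; the diagonal term needs 2 B 2.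
  refine ⟨4 * C + 2 * B 2, by positivity, fun X hX hXm b S => ?_⟩
  induction S using Finset.induction_on with
  | empty => intro _ _ _ _ _; simp
  | insert m S hm ihS =>
    intro hb hmom hmean hvar hbd
    have hsub : ∀ j ∈ S, j ∈ insert m S := fun j hj => Finset.mem_insert_of_mem hj
    have hmS := Finset.mem_insert_self m S
    have ih := ihS (fun i hi j hj => hb i (hsub i hi) j (hsub j hj))
      (fun j hj => hmom j (hsub j hj))
      (fun j hj => hmean j (hsub j hj)) (fun j hj => hvar j (hsub j hj))
      (fun j hj => hbd j (hsub j hj))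
    set Y : Ω → ℝ := fun ω => ∑ i ∈ S, ∑ j ∈ S, b i j * (X i ω * X j ω) - ∑ i ∈ S, b i i with hY
    set L : Ω → ℝ := fun ω => ∑ j ∈ S, (2 * b m j) * X j ω with hL
    have hXmm := hmom m hmS
    have hLterm : ∀ j ∈ S, HasAllMoments (fun ω => (2 * b m j) * X j ω) P := fun j hj =>
      (HasAllMoments.const _).mul (hmom j (hsub j hj))
    have hLmom : HasAllMoments L P := HasAllMoments.sum hLterm
    have hYmom : HasAllMoments Y P := (HasAllMoments.sum fun i hi => HasAllMoments.sum fun j hj =>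
      (HasAllMoments.const _).mul ((hmom i (hsub i hi)).mul (hmom j (hsub j hj)))).sub
        (HasAllMoments.const _)
    have hdisj : Disjoint (S : Set ι) {m} := by simpa using hm
    have hXS : ∀ j ∈ S, Measurable[⨆ i ∈ (S : Set ι),
        MeasurableSpace.comap (X i) inferInstance] (X j) := fun j hj => measurable_iSup_comap X hj
    have hYmeas : Measurable[⨆ i ∈ (S : Set ι), MeasurableSpace.comap (X i) inferInstance] Y :=
      (Finset.measurable_sum _ fun i hi => Finset.measurable_sum _ fun j hj =>
        ((hXS i hi).mul (hXS j hj)).const_mul _).sub_const _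
    have hLmeas : Measurable[⨆ i ∈ (S : Set ι), MeasurableSpace.comap (X i) inferInstance] L :=
      Finset.measurable_sum _ fun j hj => (hXS j hj).const_mul _
    have hmmeas := measurable_iSup_comap X (Set.mem_singleton m)
    have hle : (⨆ i ∈ (S : Set ι), MeasurableSpace.comap (X i) inferInstance) ≤
        ‹MeasurableSpace Ω› :=
      iSup₂_le fun i _ => (hXm i).comap_le
    have hind : ∀ {f : Ω → ℝ} {g : ℝ → ℝ}, Measurable g →
        Measurable[⨆ i ∈ (S : Set ι), MeasurableSpace.comap (X i) inferInstance] f →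
        ∫ ω, f ω * g (X m ω) ∂P = (∫ ω, f ω ∂P) * ∫ ω, g (X m ω) ∂P := by
      intro f g hg hf
      exact (iIndepFun.indepFun_of_measurable_iSup hX hXm hdisj hf (hg.comp hmmeas))
        |>.integral_fun_mul_eq_mul_integral (hf.mono hle le_rfl).aestronglyMeasurable
          (hg.comp (hXm m)).aestronglyMeasurable
    have i1 : ∫ ω, Y ω * L ω * X m ω ∂P = 0 := by
      have := hind measurable_id (hYmeas.mul hLmeas)
      simp only [Pi.mul_apply, id] at this
      rw [this, hmean m hmS, mul_zero]
    have i2 : ∫ ω, Y ω * (X m ω ^ 2 - 1) ∂P = 0 := by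
      rw [hind (g := fun x => x ^ 2 - 1) (by fun_prop) hYmeas, integral_sub
        (hXmm.pow 2).integrable (integrable_const 1), hvar m hmS]
      simp
    have i3 : ∫ ω, L ω ^ 2 * X m ω ^ 2 ∂P = ∫ ω, L ω ^ 2 ∂P := by
      rw [hind (g := fun x => x ^ 2) (by fun_prop) (hLmeas.pow_const 2), hvar m hmS, mul_one]
    have i4 : ∫ ω, (X m ω ^ 2 - 1) ^ 2 ∂P ≤ B 2 := by
      have e : ∀ ω, (X m ω ^ 2 - 1) ^ 2 = X m ω ^ 4 - 2 * X m ω ^ 2 + 1 := fun ω => by ring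
      simp_rw [e]
      rw [integral_add, integral_sub, integral_const_mul, hvar m hmS]
      · have := hbd m hmS 2
        simp only [Nat.reduceMul] at this
        simp only [integral_const, probReal_univ, smul_eq_mul]
        linarith
      exacts [(hXmm.pow 4).integrable, (hXmm.pow 2).integrable.const_mul _,
        (hXmm.pow 4).integrable.sub ((hXmm.pow 2).integrable.const_mul _), integrable_const 1]
    have i5 : ∫ ω, L ω ^ 2 ∂P ≤ C * ∑ j ∈ S, (2 * b m j) ^ 2 := by
      have := h (fun j ω => (2 * b m j) * X j ω) (fun j => (2 * b m j) ^ 2)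
        (hX.comp (fun j x => (2 * b m j) * x) fun j => measurable_const_mul _)
        (fun j => (hXm j).const_mul _) (fun j => sq_nonneg _) S hLterm ?_ ?_
      · simpa using this
      · intro j hj
        rw [integral_const_mul, hmean j (hsub j hj), mul_zero]
      · intro j hj q
        simp_rw [mul_pow _ (X j _)]
        rw [integral_const_mul, ← pow_mul, mul_comm]
        exact mul_le_mul_of_nonneg_right (hbd j (hsub j hj) q) ((even_two_mul q).pow_nonneg _)
    have hdecomp : ∀ ω, ∑ i ∈ insert m S, ∑ j ∈ insert m S, b i j * (X i ω * X j ω) -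
        ∑ i ∈ insert m S, b i i = Y ω + (L ω * X m ω + b m m * (X m ω ^ 2 - 1)) := by
      intro ω
      have e1 : ∑ i ∈ S, b i m * (X i ω * X m ω) = ∑ j ∈ S, b m j * (X m ω * X j ω) :=
        Finset.sum_congr rfl fun j hj => by rw [hb j (hsub j hj) m hmS]; ring
      have e2 : L ω * X m ω = 2 * ∑ j ∈ S, b m j * (X m ω * X j ω) := by
        rw [hL, Finset.mul_sum, Finset.sum_mul]
        exact Finset.sum_congr rfl fun j _ => by ring
      simp only [Finset.sum_insert hm, Finset.sum_add_distrib]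
      rw [e1, e2, hY]
      ring
    simp_rw [hdecomp]
    have hpt : ∀ ω, (Y ω + (L ω * X m ω + b m m * (X m ω ^ 2 - 1))) ^ 2 ≤
        Y ω ^ 2 + 2 * (Y ω * L ω * X m ω) + (2 * b m m) * (Y ω * (X m ω ^ 2 - 1)) +
        2 * (L ω ^ 2 * X m ω ^ 2) + (2 * b m m ^ 2) * (X m ω ^ 2 - 1) ^ 2 := fun ω => by
      nlinarith [sq_nonneg (L ω * X m ω - b m m * (X m ω ^ 2 - 1))]
    have hX1 : HasAllMoments (fun ω => X m ω ^ 2 - 1) P := (hXmm.pow 2).sub (HasAllMoments.const 1)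
    have j1 := (hYmom.pow 2).integrable
    have j2 := ((hYmom.mul hLmom).mul hXmm).integrable.const_mul 2
    have j3 := (hYmom.mul hX1).integrable.const_mul (2 * b m m)
    have j4 := ((hLmom.pow 2).mul (hXmm.pow 2)).integrable.const_mul 2
    have j5 := (hX1.pow 2).integrable.const_mul (2 * b m m ^ 2)
    have hint := integral_mono ((hYmom.add ((hLmom.mul hXmm).add
      ((HasAllMoments.const (b m m)).mul hX1))).pow 2).integrable
      ((((j1.add j2).add j3).add j4).add j5) hpt
    have e : ∫ ω, (Y ω ^ 2 + 2 * (Y ω * L ω * X m ω) + (2 * b m m) * (Y ω * (X m ω ^ 2 - 1)) +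
        2 * (L ω ^ 2 * X m ω ^ 2) + (2 * b m m ^ 2) * (X m ω ^ 2 - 1) ^ 2) ∂P =
        ∫ ω, Y ω ^ 2 ∂P + 2 * ∫ ω, L ω ^ 2 ∂P +
          (2 * b m m ^ 2) * ∫ ω, (X m ω ^ 2 - 1) ^ 2 ∂P := by
      rw [integral_add, integral_add, integral_add, integral_add, integral_const_mul,
        integral_const_mul, integral_const_mul, integral_const_mul, i1, i2, i3]
      · ring
      exacts [j1, j2, j1.add j2, j3, (j1.add j2).add j3, j4, ((j1.add j2).add j3).add j4, j5]
    have hint' := hint.trans (le_of_eq e)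
    refine hint'.trans ?_
    have e1 : ∑ i ∈ S, b i m ^ 2 = ∑ j ∈ S, b m j ^ 2 :=
      Finset.sum_congr rfl fun j hj => by rw [hb j (hsub j hj) m hmS]
    have e2 : ∑ j ∈ S, (2 * b m j) ^ 2 = 4 * ∑ j ∈ S, b m j ^ 2 := by
      rw [Finset.mul_sum]
      exact Finset.sum_congr rfl fun j _ => by ring
    simp only [Finset.sum_insert hm, Finset.sum_add_distrib]
    rw [e1]
    rw [e2] at i5
    have k1 := mul_le_mul_of_nonneg_left i4 (by positivity : 0 ≤ 2 * b m m ^ 2)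
    have k2 : 0 ≤ ∑ j ∈ S, b m j ^ 2 := Finset.sum_nonneg fun j _ => sq_nonneg _
    have k3 : 0 ≤ C * b m m ^ 2 := by positivity
    have k4 : 0 ≤ B 2 * ∑ j ∈ S, b m j ^ 2 := mul_nonneg hB2 k2
    linear_combination ih + 2 * i5 + k1 + 4 * k3 + 4 * k4

end Independence

/-! ### Calculus of sequences bounded, or vanishing, in every L^p. -/

section MomentSequences

open scoped ENNReal NNReal

variable {Ω : Type*} [MeasurableSpace Ω] {P : Measure Ω}

/-- Every moment of the sequence `f` is eventually bounded. -/
structure MomentBounded (f : ℕ → Ω → ℝ) (P : Measure Ω) : Prop where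
  aestronglyMeasurable : ∀ N, AEStronglyMeasurable (f N) P
  bound : ∀ p : ℕ, 1 ≤ p → ∃ C : ℝ≥0, ∀ᶠ N in atTop, eLpNorm (f N) p P ≤ C

/-- The sequence `f` tends to zero in `L^p` for every natural number `p ≥ 1`. -/
structure MomentSmall (f : ℕ → Ω → ℝ) (P : Measure Ω) : Prop where
  aestronglyMeasurable : ∀ N, AEStronglyMeasurable (f N) P
  tendsto : ∀ p : ℕ, 1 ≤ p → Tendsto (fun N => eLpNorm (f N) p P) atTop (𝓝 0)

theorem ENNReal.tendsto_zero_of_pow {u : ℕ → ℝ≥0∞} {p : ℕ} (hp : p ≠ 0)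
    (h : Tendsto (fun N => u N ^ p) atTop (𝓝 0)) : Tendsto u atTop (𝓝 0) := by
  have h4 := (ENNReal.continuous_rpow_const (y := (p : ℝ)⁻¹)).tendsto 0 |>.comp h
  rw [ENNReal.zero_rpow_of_pos (by positivity)] at h4
  refine h4.congr fun N => ?_
  simp only [Function.comp_apply]
  rw [← ENNReal.rpow_natCast, ← ENNReal.rpow_mul, mul_inv_cancel₀ (by exact_mod_cast hp),
    ENNReal.rpow_one]

theorem eLpNorm_mul_le {f g : Ω → ℝ} (hf : AEStronglyMeasurable f P)
    (hg : AEStronglyMeasurable g P) (p : ℕ) :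
    eLpNorm (fun ω => f ω * g ω) p P ≤
      eLpNorm f (2 * p : ℕ) P * eLpNorm g (2 * p : ℕ) P := by
  have h := eLpNorm_smul_le_mul_eLpNorm (p := ((2 * p : ℕ) : ℝ≥0∞)) (q := ((2 * p : ℕ) : ℝ≥0∞))
    (r := (p : ℝ≥0∞)) hg hf (hpqr := holderTriple_two_mul p)
  rwa [show f • g = fun ω => f ω * g ω from rfl] at h

namespace MomentSmall

variable {f g : ℕ → Ω → ℝ}

theorem momentBounded (hf : MomentSmall f P) : MomentBounded f P where
  aestronglyMeasurable := hf.aestronglyMeasurable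
  bound p hp := ⟨1, by
    filter_upwards [(hf.tendsto p hp).eventually (gt_mem_nhds one_pos)] with N hN
    exact_mod_cast hN.le⟩

theorem zero : MomentSmall (fun _ _ => 0 : ℕ → Ω → ℝ) P where
  aestronglyMeasurable _ := aestronglyMeasurable_const
  tendsto p _ := by simp

theorem add (hf : MomentSmall f P) (hg : MomentSmall g P) :
    MomentSmall (fun N ω => f N ω + g N ω) P where
  aestronglyMeasurable N := (hf.aestronglyMeasurable N).add (hg.aestronglyMeasurable N)
  tendsto p hp := by
    have := (hf.tendsto p hp).add (hg.tendsto p hp)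
    rw [add_zero] at this
    exact tendsto_of_tendsto_of_tendsto_of_le_of_le tendsto_const_nhds this (fun _ => zero_le)
      fun N => eLpNorm_add_le (hf.aestronglyMeasurable N) (hg.aestronglyMeasurable N)
        (by exact_mod_cast hp)

theorem sum {ι : Type*} {F : ι → ℕ → Ω → ℝ} (S : Finset ι) (h : ∀ i ∈ S, MomentSmall (F i) P) :
    MomentSmall (fun N ω => ∑ i ∈ S, F i N ω) P := by
  classical
  induction S using Finset.induction_on with
  | empty => simpa using zero
  | insert a S ha ih =>
    simp_rw [Finset.sum_insert ha]
    exact (h a (Finset.mem_insert_self a S)).add (ih fun i hi => h i (Finset.mem_insert_of_mem hi))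

theorem mul_momentBounded (hf : MomentSmall f P) (hg : MomentBounded g P) :
    MomentSmall (fun N ω => f N ω * g N ω) P where
  aestronglyMeasurable N := (hf.aestronglyMeasurable N).mul (hg.aestronglyMeasurable N)
  tendsto p hp := by
    obtain ⟨C, hC⟩ := hg.bound (2 * p) (by omega)
    have h1 := ENNReal.Tendsto.mul_const (b := (C : ℝ≥0∞)) (hf.tendsto (2 * p) (by omega))
      (Or.inr ENNReal.coe_ne_top)
    rw [zero_mul] at h1
    refine tendsto_of_tendsto_of_tendsto_of_le_of_le' tendsto_const_nhds h1
      (Eventually.of_forall fun _ => zero_le) ?_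
    filter_upwards [hC] with N hN
    exact (eLpNorm_mul_le (hf.aestronglyMeasurable N) (hg.aestronglyMeasurable N) p).trans
      (mul_le_mul_right hN _)

theorem congr' (hf : MomentSmall f P) (hg : ∀ N, AEStronglyMeasurable (g N) P)
    (h : ∀ᶠ N in atTop, f N = g N) : MomentSmall g P where
  aestronglyMeasurable := hg
  tendsto p hp := (hf.tendsto p hp).congr' (by filter_upwards [h] with N hN; rw [hN])

theorem const [IsFiniteMeasure P] {c : ℕ → ℝ} (hc : Tendsto c atTop (𝓝 0)) :
    MomentSmall (fun N (_ : Ω) => c N) P where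
  aestronglyMeasurable _ := aestronglyMeasurable_const
  tendsto p hp := by
    have hp0 : (p : ℝ≥0∞) ≠ 0 := by exact_mod_cast (by omega : p ≠ 0)
    simp_rw [eLpNorm_const' _ hp0 (ENNReal.natCast_ne_top p)]
    have h2 := ENNReal.Tendsto.mul_const (b := P Set.univ ^ (1 / (p : ℝ≥0∞).toReal))
      (continuous_enorm.tendsto (0 : ℝ) |>.comp hc)
      (Or.inr (ENNReal.rpow_ne_top_of_nonneg (by positivity) (measure_ne_top _ _)))
    simpa using h2

end MomentSmall

namespace MomentBounded

variable {f g : ℕ → Ω → ℝ}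

theorem const [IsProbabilityMeasure P] (c : ℝ) : MomentBounded (fun _ (_ : Ω) => c) P where
  aestronglyMeasurable _ := aestronglyMeasurable_const
  bound p hp := ⟨‖c‖₊, Eventually.of_forall fun _ => by
    have hp0 : (p : ℝ≥0∞) ≠ 0 := by exact_mod_cast (by omega : p ≠ 0)
    rw [eLpNorm_const' _ hp0 (ENNReal.natCast_ne_top p)]
    simp [enorm_eq_nnnorm]⟩

theorem add (hf : MomentBounded f P) (hg : MomentBounded g P) :
    MomentBounded (fun N ω => f N ω + g N ω) P where
  aestronglyMeasurable N := (hf.aestronglyMeasurable N).add (hg.aestronglyMeasurable N)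
  bound p hp := by
    obtain ⟨C, hC⟩ := hf.bound p hp
    obtain ⟨D, hD⟩ := hg.bound p hp
    refine ⟨C + D, ?_⟩
    filter_upwards [hC, hD] with N h1 h2
    rw [ENNReal.coe_add]
    exact (eLpNorm_add_le (hf.aestronglyMeasurable N) (hg.aestronglyMeasurable N)
        (by exact_mod_cast hp)).trans (add_le_add h1 h2)

theorem mul (hf : MomentBounded f P) (hg : MomentBounded g P) :
    MomentBounded (fun N ω => f N ω * g N ω) P where
  aestronglyMeasurable N := (hf.aestronglyMeasurable N).mul (hg.aestronglyMeasurable N)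
  bound p hp := by
    obtain ⟨C, hC⟩ := hf.bound (2 * p) (by omega)
    obtain ⟨D, hD⟩ := hg.bound (2 * p) (by omega)
    refine ⟨C * D, ?_⟩
    filter_upwards [hC, hD] with N h1 h2
    rw [ENNReal.coe_mul]
    exact (eLpNorm_mul_le (hf.aestronglyMeasurable N) (hg.aestronglyMeasurable N) p).trans
      (mul_le_mul' h1 h2)

theorem pow [IsProbabilityMeasure P] (hf : MomentBounded f P) (n : ℕ) :
    MomentBounded (fun N ω => f N ω ^ n) P := by
  induction n with
  | zero => simpa using const 1
  | succ n ih => simpa only [pow_succ] using ih.mul hf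

theorem sum [IsProbabilityMeasure P] {ι : Type*} {F : ι → ℕ → Ω → ℝ} (S : Finset ι)
    (h : ∀ i ∈ S, MomentBounded (F i) P) : MomentBounded (fun N ω => ∑ i ∈ S, F i N ω) P := by
  classical
  induction S using Finset.induction_on with
  | empty => simpa using const 0
  | insert a S ha ih =>
    simp_rw [Finset.sum_insert ha]
    exact (h a (Finset.mem_insert_self a S)).add (ih fun i hi => h i (Finset.mem_insert_of_mem hi))

theorem mono (hf : MomentBounded f P) (hg : ∀ N, AEStronglyMeasurable (g N) P)
    (h : ∀ N ω, |g N ω| ≤ |f N ω|) : MomentBounded g P where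
  aestronglyMeasurable := hg
  bound p hp := by
    obtain ⟨C, hC⟩ := hf.bound p hp
    refine ⟨C, ?_⟩
    filter_upwards [hC] with N hN
    exact (eLpNorm_mono fun ω => h N ω).trans hN

/-- Cauchy–Schwarz applied to |f|^p = |f| |f|^(p-1): one factor tends to 0 in L², the other stays
bounded. -/
theorem momentSmall_of_tendsto_two [IsProbabilityMeasure P] (hf : MomentBounded f P)
    (h : Tendsto (fun N => eLpNorm (f N) 2 P) atTop (𝓝 0)) : MomentSmall f P where
  aestronglyMeasurable := hf.aestronglyMeasurable
  tendsto p hp := by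
    have hp0 : p ≠ 0 := by omega
    obtain ⟨C, hC⟩ := (hf.pow (p - 1)).bound 2 one_le_two
    refine ENNReal.tendsto_zero_of_pow hp0 ?_
    have h2 := ENNReal.Tendsto.mul_const (b := (C : ℝ≥0∞)) h (Or.inr ENNReal.coe_ne_top)
    rw [zero_mul] at h2
    refine tendsto_of_tendsto_of_tendsto_of_le_of_le' tendsto_const_nhds h2
      (Eventually.of_forall fun _ => zero_le) ?_
    filter_upwards [hC] with N hN
    have h3 := eLpNorm_mul_le (hf.aestronglyMeasurable N)
      ((hf.pow (p - 1)).aestronglyMeasurable N) 1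
    rw [mul_one, Nat.cast_one, eLpNorm_one_eq_lintegral_enorm] at h3
    rw [eLpNorm_pow_eq_lintegral _ hp0]
    refine (le_of_eq (lintegral_congr fun ω => ?_)).trans (h3.trans ?_)
    · rw [← pow_succ', Nat.sub_add_cancel hp, enorm_pow]
    · exact mul_le_mul' (by simp) hN

end MomentBounded

/-- Taking for `r N` the index of largest norm reduces averages to sequences with one index each.
This replaces uniformity in the index by quantification over all sequences `r`. -/
theorem exists_eLpNorm_average_le {g : ℕ → ℕ → Ω → ℝ} {S : ℕ → Finset ℕ}
    (hcard : ∀ N, (S N).card ≤ N + 1) (hg : ∀ N i, AEStronglyMeasurable (g N i) P) {p : ℕ}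
    (hp : 1 ≤ p) : ∃ r : ℕ → ℕ, (∀ N, (S N).Nonempty → r N ∈ S N) ∧
      ∀ N : ℕ, eLpNorm (fun ω => 1 / (N : ℝ) * ∑ i ∈ S N, g N i ω) p P ≤
        2 * eLpNorm (g N (r N)) p P := by
  have h1 : ∀ N, ∃ r, (S N).Nonempty →
      r ∈ S N ∧ ∀ i ∈ S N, eLpNorm (g N i) p P ≤ eLpNorm (g N r) p P := by
    intro N
    by_cases h : (S N).Nonempty
    · obtain ⟨r, hr, hmax⟩ := (S N).exists_max_image (fun i => eLpNorm (g N i) p P) h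
      exact ⟨r, fun _ => ⟨hr, hmax⟩⟩
    · exact ⟨0, fun h' => absurd h' h⟩
  choose r hr using h1
  refine ⟨r, fun N hN => (hr N hN).1, fun N => ?_⟩
  -- For N = 0 the average is zero because 1 / 0 = 0; for N ≥ 1 the constant 2 bounds (N + 1) / N.
  rcases Nat.eq_zero_or_pos N with rfl | hN
  · simp
  have h2 : eLpNorm (∑ i ∈ S N, g N i) p P ≤ (N + 1) * eLpNorm (g N (r N)) p P := by
    refine (eLpNorm_sum_le (fun i _ => hg N i) (by exact_mod_cast hp)).trans ?_
    refine (Finset.sum_le_card_nsmul _ _ (eLpNorm (g N (r N)) p P) fun i hi =>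
      (hr N ⟨i, hi⟩).2 i hi).trans ?_
    rw [nsmul_eq_mul]
    exact mul_le_mul_left (by exact_mod_cast hcard N) _
  have h3 : (fun ω => 1 / (N : ℝ) * ∑ i ∈ S N, g N i ω) = (1 / (N : ℝ)) • ∑ i ∈ S N, g N i := by
    ext ω
    simp
  rw [h3, eLpNorm_const_smul]
  refine (mul_le_mul_right h2 _).trans ?_
  rw [← mul_assoc]
  refine mul_le_mul_left ?_ _
  have hN1 : (1 : ℝ) ≤ N := by exact_mod_cast hN
  have e1 : (N + 1 : ℝ≥0∞) = ENNReal.ofReal (N + 1) := by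
    rw [ENNReal.ofReal_add (by positivity) zero_le_one]
    simp
  rw [Real.enorm_of_nonneg (by positivity), e1, ← ENNReal.ofReal_mul (by positivity),
    show (2 : ℝ≥0∞) = ENNReal.ofReal 2 by simp]
  refine ENNReal.ofReal_le_ofReal ?_
  rw [one_div, inv_mul_le_iff₀ (by positivity)]
  linarith

theorem MomentBounded.average {g : ℕ → ℕ → Ω → ℝ} {S : ℕ → Finset ℕ}
    (hcard : ∀ N, (S N).card ≤ N + 1) (hg : ∀ N i, AEStronglyMeasurable (g N i) P)
    (h : ∀ r : ℕ → ℕ, (∀ N, (S N).Nonempty → r N ∈ S N) →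
      MomentBounded (fun N => g N (r N)) P) :
    MomentBounded (fun N ω => 1 / (N : ℝ) * ∑ i ∈ S N, g N i ω) P where
  aestronglyMeasurable N :=
    (Finset.aestronglyMeasurable_fun_sum (S N) fun i _ => hg N i).const_mul _
  bound p hp := by
    obtain ⟨r, hr, hle⟩ := exists_eLpNorm_average_le hcard hg hp
    obtain ⟨C, hC⟩ := (h r hr).bound p hp
    refine ⟨2 * C, ?_⟩
    filter_upwards [hC] with N hN
    rw [ENNReal.coe_mul]
    exact (hle N).trans (mul_le_mul_right hN _)

theorem MomentSmall.average {g : ℕ → ℕ → Ω → ℝ} {S : ℕ → Finset ℕ}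
    (hcard : ∀ N, (S N).card ≤ N + 1) (hg : ∀ N i, AEStronglyMeasurable (g N i) P)
    (h : ∀ r : ℕ → ℕ, (∀ N, (S N).Nonempty → r N ∈ S N) →
      MomentSmall (fun N => g N (r N)) P) :
    MomentSmall (fun N ω => 1 / (N : ℝ) * ∑ i ∈ S N, g N i ω) P where
  aestronglyMeasurable N :=
    (Finset.aestronglyMeasurable_fun_sum (S N) fun i _ => hg N i).const_mul _
  tendsto p hp := by
    obtain ⟨r, hr, hle⟩ := exists_eLpNorm_average_le hcard hg hp
    have := ENNReal.Tendsto.const_mul (a := 2) ((h r hr).tendsto p hp) (Or.inr ENNReal.ofNat_ne_top)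
    rw [mul_zero] at this
    exact tendsto_of_tendsto_of_tendsto_of_le_of_le tendsto_const_nhds this (fun _ => zero_le) hle

end MomentSequences

/-! ### Uniform moment bounds for walks on the Wigner array. -/

section WignerArray

open scoped ENNReal NNReal

theorem measurable_walkSum {Ω ι : Type*} [DecidableEq ι] {_ : MeasurableSpace Ω}
    {M : Ω → ι → ι → ℝ} {S : Finset ι} {U : Set ι} (hSU : ∀ i ∈ S, i ∈ U)
    (h : ∀ i ∈ U, ∀ j ∈ S, Measurable fun ω => M ω i j) (n : ℕ) (j : ι) :
    ∀ i ∈ U, Measurable fun ω => walkSum (M ω) S n i j := by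
  induction n with
  | zero => intro i _; exact measurable_const
  | succ n ih =>
    intro i hi
    exact Finset.measurable_sum S fun k hk => (h i hi k hk).mul (ih k (hSU k hk))

theorem walkSum_succ_of_notMem {ι : Type*} [DecidableEq ι] (M : ι → ι → ℝ) {S : Finset ι} {r : ι}
    (hr : r ∉ S) (n : ℕ) (i : ι) : walkSum M S (n + 1) i r = 0 := by
  induction n generalizing i with
  | zero => simp [walkSum_succ, walkSum_zero, hr]
  | succ n ih => rw [walkSum_succ]; exact Finset.sum_eq_zero fun k _ => by rw [ih, mul_zero]

variable {Ω : Type*} [MeasurableSpace Ω] {P : Measure Ω}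

theorem HasAllMoments.walkSum [IsFiniteMeasure P] {ι : Type*} [DecidableEq ι]
    {M : Ω → ι → ι → ℝ} (h : ∀ i j, HasAllMoments (fun ω => M ω i j) P) (S : Finset ι) (n : ℕ)
    (i j : ι) : HasAllMoments (fun ω => walkSum (M ω) S n i j) P := by
  induction n generalizing i with
  | zero => exact HasAllMoments.const _
  | succ n ih => exact HasAllMoments.sum fun k _ => (h i k).mul (ih k)

/-- The entries `N^{-1/2} x i j` of the Wigner matrix, as an array indexed by `ℕ`. -/
noncomputable def scaledArray (x : ℕ → ℕ → Ω → ℝ) (N : ℕ) (ω : Ω) (i j : ℕ) : ℝ :=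
  1 / √(N : ℝ) * x i j ω

namespace IsWignerArray

variable {x : ℕ → ℕ → Ω → ℝ}

theorem hasAllMoments (hx : IsWignerArray P x) (i j : ℕ) : HasAllMoments (x i j) P := by
  intro p
  rcases Nat.eq_zero_or_pos p with rfl | hp
  · simpa using (hx.measurable i j).aestronglyMeasurable
  · rw [← integrable_norm_rpow_iff (hx.measurable i j).aestronglyMeasurable
      (by exact_mod_cast hp.ne') (by simp)]
    simpa using hx.integrable_abs_pow p i j

theorem exists_moment_bound (hx : IsWignerArray P x) : ∃ B : ℕ → ℝ, (∀ p, 0 ≤ B p) ∧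
    ∀ i j p, ∫ ω, x i j ω ^ (2 * p) ∂P ≤ B p := by
  have hnn : ∀ i j p, 0 ≤ ∫ ω, x i j ω ^ (2 * p) ∂P := fun i j p =>
    integral_nonneg fun ω => (even_two_mul p).pow_nonneg _
  have hoff : ∀ i j p, i < j → ∫ ω, x i j ω ^ (2 * p) ∂P = ∫ ω, x 0 1 ω ^ (2 * p) ∂P :=
    fun i j p hij => ((hx.identDistrib_offDiag i j hij).comp
      (measurable_id.pow_const (2 * p))).integral_eq
  have hdiag : ∀ i p, ∫ ω, x i i ω ^ (2 * p) ∂P = ∫ ω, x 0 0 ω ^ (2 * p) ∂P :=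
    fun i p => ((hx.identDistrib_diag i).comp (measurable_id.pow_const (2 * p))).integral_eq
  refine ⟨fun p => ∫ ω, x 0 1 ω ^ (2 * p) ∂P + ∫ ω, x 0 0 ω ^ (2 * p) ∂P,
    fun p => add_nonneg (hnn _ _ _) (hnn _ _ _), fun i j p => ?_⟩
  have h1 := hnn 0 1 p
  have h2 := hnn 0 0 p
  rcases lt_trichotomy i j with h | rfl | h
  · rw [hoff i j p h]; linarith
  · rw [hdiag i p]; linarith
  · rw [hx.symm, hoff j i p h]; linarith

theorem integral_sq (hx : IsWignerArray P x) {i j : ℕ} (hij : i ≠ j) [IsProbabilityMeasure P] :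
    ∫ ω, x i j ω ^ 2 ∂P = 1 := by
  rcases lt_or_gt_of_ne hij with h | h
  · rw [← hx.variance_offDiag i j h,
      variance_of_integral_eq_zero (hx.measurable i j).aemeasurable (hx.mean_zero i j)]
  · rw [hx.symm, ← hx.variance_offDiag j i h,
      variance_of_integral_eq_zero (hx.measurable j i).aemeasurable (hx.mean_zero j i)]

/-- The index, in the family of independent entries, of the entry at `i` and `j`. -/
def sortedPair (i j : ℕ) : {p : ℕ × ℕ // p.1 ≤ p.2} :=
  ⟨(min i j, max i j), min_le_max⟩

theorem eq_sortedPair (hx : IsWignerArray P x) (i j : ℕ) :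
    x i j = x (sortedPair i j).1.1 (sortedPair i j).1.2 := by
  rcases le_total i j with h | h
  · simp [sortedPair, h]
  · simpa [sortedPair, h] using hx.symm i j

theorem iIndepFun_row (hx : IsWignerArray P x) (r : ℕ) : iIndepFun (fun j => x r j) P := by
  have hinj : Function.Injective (sortedPair r) := by
    intro i j h
    have h1 : min r i = min r j := congrArg (fun p => p.1.1) h
    have h2 : max r i = max r j := congrArg (fun p => p.1.2) h
    omega
  have := hx.indep.precomp hinj
  rw [show (fun j => x r j) = fun j => x (sortedPair r j).1.1 (sortedPair r j).1.2 from
    funext fun j => hx.eq_sortedPair r j]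
  exact this

/-- Walks inside `S` read only entries with both indices in `S`, whereas row `r` reads only entries
with an index equal to `r`. -/
theorem exists_indepFun_walkSum_row (hx : IsWignerArray P x) {S : Finset ℕ} {r : ℕ} (hr : r ∉ S)
    (N m : ℕ) : ∃ A : Ω → ℕ → ℕ → ℝ, Measurable A ∧ IndepFun A (fun ω j => x r j ω) P ∧
      ∀ ω, ∀ i ∈ S, ∀ j, A ω i j = walkSum (scaledArray x N ω) S m i j := by
  let U : Set {p : ℕ × ℕ // p.1 ≤ p.2} := {p | p.1.1 ∈ S ∧ p.1.2 ∈ S}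
  let V : Set {p : ℕ × ℕ // p.1 ≤ p.2} := {p | p.1.1 = r ∨ p.1.2 = r}
  have hUV : Disjoint U V := by
    rw [Set.disjoint_left]
    rintro p ⟨h1, h2⟩ (h | h)
    · exact hr (h ▸ h1)
    · exact hr (h ▸ h2)
  have hle : (⨆ p ∈ U, MeasurableSpace.comap (fun ω => x p.1.1 p.1.2 ω) inferInstance) ≤
      ‹MeasurableSpace Ω› := iSup₂_le fun p _ => (hx.measurable p.1.1 p.1.2).comap_le
  have hA : Measurable[⨆ p ∈ U, MeasurableSpace.comap (fun ω => x p.1.1 p.1.2 ω) inferInstance]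
      (fun ω i j => if i ∈ S then walkSum (scaledArray x N ω) S m i j else 0) := by
    refine @measurable_pi_lambda _ _ _ (_) _ _ fun i =>
      @measurable_pi_lambda _ _ _ (_) _ _ fun j => ?_
    by_cases hi : i ∈ S
    · simp only [hi, if_true]
      refine measurable_walkSum (U := (S : Set ℕ)) (fun i hi => hi) ?_ m j i hi
      intro k hk l hl
      refine Measurable.const_mul ?_ _
      rw [hx.eq_sortedPair k l]
      refine measurable_iSup_comap (fun p : {p : ℕ × ℕ // p.1 ≤ p.2} => x p.1.1 p.1.2)
        (j := sortedPair k l) ?_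
      rcases le_total k l with h | h
      · simpa [U, sortedPair, h] using ⟨hk, hl⟩
      · simpa [U, sortedPair, h] using ⟨hl, hk⟩
    · simp only [hi, if_false]
      exact measurable_const
  -- Setting the array to zero for `i ∉ S` is needed because a walk sum started outside `S` would
  -- read entries of row `i`, possibly row `r` itself.
  refine ⟨fun ω i j => if i ∈ S then walkSum (scaledArray x N ω) S m i j else 0,
    hA.mono hle le_rfl, ?_, fun ω i hi j => if_pos hi⟩
  refine iIndepFun.indepFun_of_measurable_iSup hx.indep (fun p => hx.measurable _ _) hUV hA ?_
  · refine @measurable_pi_lambda _ _ _ (_) _ _ fun j => ?_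
    rw [show (fun ω => x r j ω) = x r j from rfl, hx.eq_sortedPair r j]
    refine measurable_iSup_comap (fun p : {p : ℕ × ℕ // p.1 ≤ p.2} => x p.1.1 p.1.2)
      (j := sortedPair r j) ?_
    rcases le_total r j with h | h
    · simp [V, sortedPair, h]
    · simp [V, sortedPair, h]

theorem scaledArray_symm (hx : IsWignerArray P x) (N : ℕ) (ω : Ω) (i j : ℕ) :
    scaledArray x N ω i j = scaledArray x N ω j i := by
  rw [scaledArray, scaledArray, hx.symm]

theorem measurable_scaledArray (hx : IsWignerArray P x) (N i j : ℕ) :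
    Measurable fun ω => scaledArray x N ω i j := (hx.measurable i j).const_mul _

theorem measurable_walkSum_scaledArray (hx : IsWignerArray P x) (N : ℕ) (S : Finset ℕ)
    (n i j : ℕ) : Measurable fun ω => walkSum (scaledArray x N ω) S n i j :=
  measurable_walkSum (U := Set.univ) (fun _ _ => trivial)
    (fun i _ j _ => hx.measurable_scaledArray N i j) n j i trivial

theorem measurable_excursionSum_scaledArray (hx : IsWignerArray P x) (N : ℕ) (S : Finset ℕ)
    (r m : ℕ) : Measurable fun ω => excursionSum (scaledArray x N ω) S r m :=
  Finset.measurable_sum _ fun i _ => Finset.measurable_sum _ fun j _ =>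
    ((hx.measurable_scaledArray N r i).mul (hx.measurable_walkSum_scaledArray N _ m i j)).mul
      (hx.measurable_scaledArray N j r)

theorem momentSmall_diag [IsProbabilityMeasure P] (hx : IsWignerArray P x) (r : ℕ → ℕ) :
    MomentSmall (fun N ω => scaledArray x N ω (r N) (r N)) P := by
  have h1 : MomentBounded (fun N => x (r N) (r N)) P :=
    { aestronglyMeasurable := fun N => (hx.measurable _ _).aestronglyMeasurable
      bound := fun p _ => ⟨(eLpNorm (x 0 0) p P).toNNReal, Eventually.of_forall fun N => by
        rw [(hx.identDistrib_diag (r N)).eLpNorm_eq,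
          ENNReal.coe_toNNReal (hx.hasAllMoments 0 0 p).2.ne]⟩ }
  have h2 : Tendsto (fun N : ℕ => 1 / √(N : ℝ)) atTop (𝓝 0) :=
    tendsto_const_nhds.div_atTop
      (Real.tendsto_sqrt_atTop.comp tendsto_natCast_atTop_atTop)
  exact (MomentSmall.const h2).mul_momentBounded h1

/-- An even excursion sum is |M_T^l u|². Freezing M_T and applying the bound for sums of squared
linear forms in row `r` leaves N^{-1} times the squared Frobenius norm of M_T^l, that is, N^{-1} tr
M_T^(2l). -/
theorem exists_eLpNorm_excursionSum_le [IsProbabilityMeasure P] (hx : IsWignerArray P x) {p : ℕ}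
    (hp : p ≠ 0) : ∃ C : ℝ, ∀ (N : ℕ) (S : Finset ℕ) (r l : ℕ),
      eLpNorm (fun ω => excursionSum (scaledArray x N ω) S r (l + l)) p P ≤
        eLpNorm (fun ω => C * (1 / (N : ℝ) * ∑ k ∈ S.erase r,
          walkSum (scaledArray x N ω) (S.erase r) (l + l) k k)) p P := by
  obtain ⟨B, hB, hbd⟩ := hx.exists_moment_bound
  obtain ⟨C, hC, h⟩ := exists_eLpNorm_sum_sq_le (P := P) (ι := ℕ) (κ := ℕ) B hB hp
  refine ⟨C, fun N S r l => ?_⟩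
  set T := S.erase r with hT
  have hr : r ∉ T := Finset.notMem_erase r S
  obtain ⟨A, hAm, hAind, hA⟩ := hx.exists_indepFun_walkSum_row hr N l
  have key := IndepFun.eLpNorm_le hAind hAm (measurable_pi_lambda _ fun j => hx.measurable r j)
    (F := fun z : (ℕ → ℕ → ℝ) × (ℕ → ℝ) =>
      ∑ k ∈ T, (∑ j ∈ T, (1 / √(N : ℝ) * z.1 k j) * z.2 j) ^ 2) (by fun_prop)
    (fun a => C * ∑ k ∈ T, ∑ j ∈ T, (1 / √(N : ℝ) * a k j) ^ 2) hp fun ω => by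
      refine (h (fun j => x r j) (hx.iIndepFun_row r) (fun j => hx.measurable r j) T T
        (fun k j => 1 / √(N : ℝ) * A ω k j)
        (fun j _ => hx.hasAllMoments r j) (fun j _ => hx.mean_zero r j)
        (fun j _ q => hbd r j q)).trans (le_of_eq ?_)
      rw [Real.enorm_of_nonneg]
      exact mul_nonneg hC (Finset.sum_nonneg fun k _ => Finset.sum_nonneg fun j _ => sq_nonneg _)
  refine (le_of_eq (congrArg (fun f => eLpNorm f p P) (funext fun ω => ?_))).trans
    (key.trans (le_of_eq (congrArg (fun f => eLpNorm f p P) (funext fun ω => ?_))))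
  · rw [excursionSum_add (hx.scaledArray_symm N ω)]
    refine Finset.sum_congr rfl fun k hk => ?_
    rw [← sq, ← hT]
    congr 1
    refine Finset.sum_congr rfl fun j _ => ?_
    dsimp only
    rw [hA ω k hk, scaledArray]
    ring
  · rw [← sum_sq_walkSum (hx.scaledArray_symm N ω)]
    congr 1
    rw [Finset.mul_sum]
    refine Finset.sum_congr rfl fun k hk => ?_
    rw [Finset.mul_sum]
    refine Finset.sum_congr rfl fun j _ => ?_
    rw [hA ω k hk, mul_pow, div_pow, Real.sq_sqrt (Nat.cast_nonneg N), one_pow]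

theorem abs_excursionSum_odd_le (hx : IsWignerArray P x) (N : ℕ) (S : Finset ℕ) (r l : ℕ)
    (ω : Ω) : |excursionSum (scaledArray x N ω) S r (l + (l + 1))| ≤
      excursionSum (scaledArray x N ω) S r (l + l) +
        excursionSum (scaledArray x N ω) S r (l + 1 + (l + 1)) := by
  simp_rw [excursionSum_add (hx.scaledArray_symm N ω)]
  rw [← Finset.sum_add_distrib]
  refine (Finset.abs_sum_le_sum_abs _ _).trans (Finset.sum_le_sum fun k _ => ?_)
  generalize (∑ j ∈ S.erase r, walkSum (scaledArray x N ω) (S.erase r) l k j *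
    scaledArray x N ω r j) = a
  generalize (∑ j ∈ S.erase r, walkSum (scaledArray x N ω) (S.erase r) (l + 1) k j *
    scaledArray x N ω r j) = b
  rw [abs_le]
  constructor <;> nlinarith [sq_nonneg (a + b), sq_nonneg (a - b), sq_nonneg a, sq_nonneg b]

theorem card_erase_le {S : ℕ → Finset ℕ} (hS : ∀ N, (S N).card ≤ N + 1) (r : ℕ → ℕ) (N : ℕ) :
    ((S N).erase (r N)).card ≤ N + 1 := (Finset.card_erase_le).trans (hS N)

theorem momentBounded_excursionSum_even [IsProbabilityMeasure P] (hx : IsWignerArray P x) (l : ℕ)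
    (h : ∀ (S : ℕ → Finset ℕ) (r : ℕ → ℕ), (∀ N, (S N).card ≤ N + 1) →
      MomentBounded (fun N ω => walkSum (scaledArray x N ω) (S N) (l + l) (r N) (r N)) P)
    (S : ℕ → Finset ℕ) (r : ℕ → ℕ) (hS : ∀ N, (S N).card ≤ N + 1) :
    MomentBounded (fun N ω => excursionSum (scaledArray x N ω) (S N) (r N) (l + l)) P where
  aestronglyMeasurable N := (hx.measurable_excursionSum_scaledArray N _ _ _).aestronglyMeasurable
  bound p hp := by
    obtain ⟨C, hC⟩ := hx.exists_eLpNorm_excursionSum_le (p := p) (by omega)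
    have h1 : MomentBounded (fun N ω => 1 / (N : ℝ) * ∑ k ∈ (S N).erase (r N),
        walkSum (scaledArray x N ω) ((S N).erase (r N)) (l + l) k k) P :=
      MomentBounded.average (card_erase_le hS r)
        (fun N i => (hx.measurable_walkSum_scaledArray N _ _ i i).aestronglyMeasurable)
        fun k _ => h _ k (card_erase_le hS r)
    obtain ⟨D, hD⟩ := ((MomentBounded.const C).mul h1).bound p hp
    refine ⟨D, ?_⟩
    filter_upwards [hD] with N hN
    exact (hC N (S N) (r N) l).trans hN

/-- Strong induction through the first-return recurrence: excursions are bounded by averages of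
shorter closed walks. -/
theorem momentBounded_walkSum [IsProbabilityMeasure P] (hx : IsWignerArray P x) (n : ℕ) :
    ∀ (S : ℕ → Finset ℕ) (r : ℕ → ℕ), (∀ N, (S N).card ≤ N + 1) →
      MomentBounded (fun N ω => walkSum (scaledArray x N ω) (S N) n (r N) (r N)) P := by
  induction n using Nat.strong_induction_on with
  | _ n ih =>
    intro S r hS
    cases n with
    | zero => simpa [walkSum_zero] using MomentBounded.const 1
    | succ n =>
      have hexc : ∀ m ∈ Finset.range n, MomentBounded
          (fun N ω => excursionSum (scaledArray x N ω) (S N) (r N) m) P := by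
        intro m hm
        rw [Finset.mem_range] at hm
        rcases Nat.even_or_odd' m with ⟨l, rfl | rfl⟩
        · rw [two_mul] at hm ⊢
          exact hx.momentBounded_excursionSum_even l (ih _ (by omega)) S r hS
        -- An odd excursion needs closed walks of length up to m + 1 ≤ n, which is still below n +
        -- 1.
        · rw [show 2 * l + 1 = l + (l + 1) by ring]
          have h1 := (hx.momentBounded_excursionSum_even l (ih _ (by omega)) S r hS).add
            (hx.momentBounded_excursionSum_even (l + 1) (ih _ (by omega)) S r hS)
          refine h1.mono (fun N =>
            (hx.measurable_excursionSum_scaledArray N _ _ _).aestronglyMeasurable) fun N ω => ?_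
          exact (hx.abs_excursionSum_odd_le N (S N) (r N) l ω).trans (le_abs_self _)
      have h1 := ((hx.momentSmall_diag r).momentBounded.mul (ih n (by omega) S r hS)).add
        (MomentBounded.sum (Finset.range n) fun m hm =>
          (hexc m hm).mul (ih (n - 1 - m) (by omega) S r hS))
      refine h1.mono (fun N =>
        (hx.measurable_walkSum_scaledArray N _ _ _ _).aestronglyMeasurable) fun N ω => ?_
      by_cases hr : r N ∈ S N
      · rw [walkSum_succ_diag _ hr]
      · rw [walkSum_succ_of_notMem _ hr, abs_zero]
        exact abs_nonneg _

end IsWignerArray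

end WignerArray

/-! ### Concentration of excursion sums and identification of the limit. -/

section Limit

open scoped ENNReal NNReal

variable {Ω : Type*} [MeasurableSpace Ω] {P : Measure Ω} {x : ℕ → ℕ → Ω → ℝ}

namespace IsWignerArray

/-- The quadratic form bound with b = N^{-1} M_T^m frozen. Only off-diagonal entries of row `r`
enter, so the variance is 1; and ∑ b² = N^{-2} tr M_T^(2m), one factor 1/N better than a bounded
average. -/
theorem exists_eLpNorm_excursionSum_sub_trace_le [IsProbabilityMeasure P]
    (hx : IsWignerArray P x) : ∃ C : ℝ, ∀ (N : ℕ) (S : Finset ℕ) (r m : ℕ),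
      eLpNorm (fun ω => excursionSum (scaledArray x N ω) S r m -
        1 / (N : ℝ) * ∑ k ∈ S.erase r, walkSum (scaledArray x N ω) (S.erase r) m k k) 2 P ^ 2 ≤
        eLpNorm (fun ω => C / N * (1 / (N : ℝ) * ∑ k ∈ S.erase r,
          walkSum (scaledArray x N ω) (S.erase r) (m + m) k k)) 1 P := by
  obtain ⟨B, hB, hbd⟩ := hx.exists_moment_bound
  obtain ⟨C, hC, h⟩ := exists_integral_quadratic_form_sub_trace_sq_le (P := P) (ι := ℕ) B hB
  refine ⟨C, fun N S r m => ?_⟩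
  set T := S.erase r with hT
  have hr : r ∉ T := Finset.notMem_erase r S
  obtain ⟨A, hAm, hAind, hA⟩ := hx.exists_indepFun_walkSum_row hr N m
  have hnn : ∀ a : ℕ → ℕ → ℝ, 0 ≤ C * ∑ i ∈ T, ∑ j ∈ T, (1 / (N : ℝ) * a i j) ^ 2 := fun a =>
    mul_nonneg hC (Finset.sum_nonneg fun k _ => Finset.sum_nonneg fun j _ => sq_nonneg _)
  have key := IndepFun.eLpNorm_le hAind hAm (measurable_pi_lambda _ fun j => hx.measurable r j)
    (F := fun z : (ℕ → ℕ → ℝ) × (ℕ → ℝ) =>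
      ∑ i ∈ T, ∑ j ∈ T, (1 / (N : ℝ) * z.1 i j) * (z.2 i * z.2 j) -
        ∑ i ∈ T, 1 / (N : ℝ) * z.1 i i) (by fun_prop)
    (fun a => √(C * ∑ i ∈ T, ∑ j ∈ T, (1 / (N : ℝ) * a i j) ^ 2)) two_ne_zero fun ω => by
      have h1 := h (fun j => x r j) (hx.iIndepFun_row r) (fun j => hx.measurable r j)
        (fun i j => 1 / (N : ℝ) * A ω i j) T
        (fun i hi j hj => by
          rw [hA ω i hi, hA ω j hj, walkSum_symm (hx.scaledArray_symm N ω) T m i hi j hj])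
        (fun j _ => hx.hasAllMoments r j) (fun j _ => hx.mean_zero r j)
        (fun j hj => hx.integral_sq fun e => hr (e ▸ hj)) (fun j _ q => hbd r j q)
      have hmom : HasAllMoments (fun ω' => ∑ i ∈ T, ∑ j ∈ T, (1 / (N : ℝ) * A ω i j) *
          (x r i ω' * x r j ω') - ∑ i ∈ T, 1 / (N : ℝ) * A ω i i) P :=
        (HasAllMoments.sum fun i _ => HasAllMoments.sum fun j _ => (HasAllMoments.const _).mul
          ((hx.hasAllMoments r i).mul (hx.hasAllMoments r j))).sub (HasAllMoments.const _)
      rw [← ENNReal.pow_le_pow_left_iff two_ne_zero, eLpNorm_pow_eq_lintegral _ two_ne_zero,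
        ← enorm_pow, Real.sq_sqrt (hnn _), Real.enorm_of_nonneg (hnn _)]
      refine le_trans (le_of_eq ?_) (ENNReal.ofReal_le_ofReal h1)
      rw [ofReal_integral_eq_lintegral_ofReal (hmom.pow 2).integrable
        (ae_of_all _ fun ω => sq_nonneg _)]
      refine lintegral_congr fun ω' => ?_
      rw [← enorm_pow, Real.enorm_of_nonneg (sq_nonneg _)]
  have e1 : (fun ω => excursionSum (scaledArray x N ω) S r m -
      1 / (N : ℝ) * ∑ k ∈ T, walkSum (scaledArray x N ω) T m k k) = fun ω =>
      ∑ i ∈ T, ∑ j ∈ T, (1 / (N : ℝ) * A ω i j) * (x r i ω * x r j ω) -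
        ∑ i ∈ T, 1 / (N : ℝ) * A ω i i := by
    funext ω
    rw [excursionSum, Finset.mul_sum]
    refine congrArg₂ _ ?_ (Finset.sum_congr rfl fun i hi => by rw [hA ω i hi])
    refine Finset.sum_congr rfl fun i hi => Finset.sum_congr rfl fun j hj => ?_
    rw [hA ω i hi, scaledArray, scaledArray, hx.symm j r, ← hT]
    have : (1 / √(N : ℝ)) * (1 / √(N : ℝ)) = 1 / N := by
      rw [div_mul_div_comm, Real.mul_self_sqrt (Nat.cast_nonneg N), one_mul]
    rw [← this]
    ring
  rw [e1]
  refine (pow_le_pow_left₀ zero_le key 2).trans (le_of_eq ?_)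
  rw [eLpNorm_pow_eq_lintegral _ two_ne_zero, eLpNorm_one_eq_lintegral_enorm]
  refine lintegral_congr fun ω => ?_
  rw [← enorm_pow, Real.sq_sqrt (hnn _), ← sum_sq_walkSum (hx.scaledArray_symm N ω),
    ← mul_assoc, div_mul_div_comm, mul_one]
  congr 1
  simp_rw [mul_pow, ← Finset.mul_sum]
  rw [← mul_assoc, div_pow, one_pow, mul_one_div, sq (N : ℝ)]
  congr 1
  exact Finset.sum_congr rfl fun i hi => Finset.sum_congr rfl fun j _ => by rw [hA ω i hi]

theorem momentBounded_average_walkSum [IsProbabilityMeasure P] (hx : IsWignerArray P x)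
    {S : ℕ → Finset ℕ} (r : ℕ → ℕ) (hS : ∀ N, (S N).card ≤ N + 1) (n : ℕ) :
    MomentBounded (fun N ω => 1 / (N : ℝ) * ∑ k ∈ (S N).erase (r N),
      walkSum (scaledArray x N ω) ((S N).erase (r N)) n k k) P :=
  MomentBounded.average (card_erase_le hS r)
    (fun N i => (hx.measurable_walkSum_scaledArray N _ _ i i).aestronglyMeasurable)
    fun k _ => hx.momentBounded_walkSum n _ k (card_erase_le hS r)

theorem momentBounded_excursionSum [IsProbabilityMeasure P] (hx : IsWignerArray P x)
    {S : ℕ → Finset ℕ} (r : ℕ → ℕ) (hS : ∀ N, (S N).card ≤ N + 1) (m : ℕ) :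
    MomentBounded (fun N ω => excursionSum (scaledArray x N ω) (S N) (r N) m) P := by
  have h : ∀ l, MomentBounded
      (fun N ω => excursionSum (scaledArray x N ω) (S N) (r N) (l + l)) P := fun l =>
    hx.momentBounded_excursionSum_even l (hx.momentBounded_walkSum (l + l)) S r hS
  rcases Nat.even_or_odd' m with ⟨l, rfl | rfl⟩
  · rw [two_mul]
    exact h l
  · rw [show 2 * l + 1 = l + (l + 1) by ring]
    exact ((h l).add (h (l + 1))).mono (fun N =>
      (hx.measurable_excursionSum_scaledArray N _ _ _).aestronglyMeasurable) fun N ω =>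
        (hx.abs_excursionSum_odd_le N (S N) (r N) l ω).trans (le_abs_self _)

theorem momentSmall_excursionSum_sub_trace [IsProbabilityMeasure P] (hx : IsWignerArray P x)
    {S : ℕ → Finset ℕ} (r : ℕ → ℕ) (hS : ∀ N, (S N).card ≤ N + 1) (m : ℕ) :
    MomentSmall (fun N ω => excursionSum (scaledArray x N ω) (S N) (r N) m -
      1 / (N : ℝ) * ∑ k ∈ (S N).erase (r N),
        walkSum (scaledArray x N ω) ((S N).erase (r N)) m k k) P := by
  have hb : MomentBounded (fun N ω => excursionSum (scaledArray x N ω) (S N) (r N) m -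
      1 / (N : ℝ) * ∑ k ∈ (S N).erase (r N),
        walkSum (scaledArray x N ω) ((S N).erase (r N)) m k k) P := by
    have := (hx.momentBounded_excursionSum r hS m).add ((MomentBounded.const (-1)).mul
      (hx.momentBounded_average_walkSum r hS m))
    simpa only [neg_one_mul, ← sub_eq_add_neg] using this
  refine hb.momentSmall_of_tendsto_two (ENNReal.tendsto_zero_of_pow two_ne_zero ?_)
  obtain ⟨C, hC⟩ := hx.exists_eLpNorm_excursionSum_sub_trace_le
  have h1 := ((MomentSmall.const (P := P) (tendsto_const_div_atTop_nhds_zero_nat C)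
    ).mul_momentBounded (hx.momentBounded_average_walkSum r hS (m + m))).tendsto 1 le_rfl
  rw [Nat.cast_one] at h1
  exact tendsto_of_tendsto_of_tendsto_of_le_of_le tendsto_const_nhds h1 (fun _ => zero_le)
    fun N => hC N (S N) (r N) m

/-- Three errors: excursion minus normalized trace, the average of the deviations of closed walks on
`S.erase r`, and the defect of |T| / N from 1. -/
theorem momentSmall_excursionSum_sub_limitMoment [IsProbabilityMeasure P]
    (hx : IsWignerArray P x) {S : ℕ → Finset ℕ} {r : ℕ → ℕ} (hS : ∀ N, (S N).card ≤ N + 1)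
    (hlim : Tendsto (fun N => ((S N).card : ℝ) / N) atTop (𝓝 1)) (hr : ∀ᶠ N in atTop, r N ∈ S N)
    (m : ℕ) (h : ∀ (S : ℕ → Finset ℕ) (r : ℕ → ℕ), (∀ N, (S N).card ≤ N + 1) →
      Tendsto (fun N => ((S N).card : ℝ) / N) atTop (𝓝 1) → (∀ᶠ N in atTop, r N ∈ S N) →
      MomentSmall (fun N ω => walkSum (scaledArray x N ω) (S N) m (r N) (r N) -
        limitMoment 1 m) P) :
    MomentSmall (fun N ω => excursionSum (scaledArray x N ω) (S N) (r N) m -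
      limitMoment 1 m) P := by
  have hlim' : Tendsto (fun N => (((S N).erase (r N)).card : ℝ) / N) atTop (𝓝 1) := by
    have h1 := hlim.sub (tendsto_const_div_atTop_nhds_zero_nat (1 : ℝ))
    rw [sub_zero] at h1
    refine h1.congr' ?_
    filter_upwards [hr] with N hN
    rw [Finset.card_erase_of_mem hN, Nat.cast_sub (Finset.card_pos.2 ⟨_, hN⟩), Nat.cast_one,
      sub_div]
  -- The maximizing index of an average lies in the set only when the set is nonempty.
  have hne : ∀ᶠ N in atTop, ((S N).erase (r N)).Nonempty := by
    filter_upwards [hlim'.eventually (lt_mem_nhds one_pos)] with N hN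
    rw [Finset.nonempty_iff_ne_empty]
    intro h0
    simp [h0] at hN
  have h1 := hx.momentSmall_excursionSum_sub_trace r hS m
  have h2 : MomentSmall (fun N ω => 1 / (N : ℝ) * ∑ k ∈ (S N).erase (r N),
      (walkSum (scaledArray x N ω) ((S N).erase (r N)) m k k - limitMoment 1 m)) P :=
    MomentSmall.average (card_erase_le hS r)
      (fun N i => ((hx.measurable_walkSum_scaledArray N _ _ i i).sub_const _).aestronglyMeasurable)
      fun k hk => h _ k (card_erase_le hS r) hlim' (hne.mono fun N hN => hk N hN)
  have h3 : MomentSmall (fun N (_ : Ω) =>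
      limitMoment 1 m * ((((S N).erase (r N)).card : ℝ) / N - 1)) P := by
    refine MomentSmall.const ?_
    have := (hlim'.sub_const 1).const_mul (limitMoment 1 m)
    rwa [sub_self, mul_zero] at this
  have e : (fun N ω => excursionSum (scaledArray x N ω) (S N) (r N) m - limitMoment 1 m) =
      fun N ω => (excursionSum (scaledArray x N ω) (S N) (r N) m -
        1 / (N : ℝ) * ∑ k ∈ (S N).erase (r N),
          walkSum (scaledArray x N ω) ((S N).erase (r N)) m k k +
        1 / (N : ℝ) * ∑ k ∈ (S N).erase (r N),
          (walkSum (scaledArray x N ω) ((S N).erase (r N)) m k k - limitMoment 1 m)) +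
        limitMoment 1 m * ((((S N).erase (r N)).card : ℝ) / N - 1) := by
    funext N ω
    rw [Finset.sum_sub_distrib, Finset.sum_const, nsmul_eq_mul]
    ring
  rw [e]
  exact (h1.add h2).add h3

/-- The factor `d` acts only on row `r`, so the unscaled excursion limits suffice for every `d`; the
case `d = 1` closes the induction. -/
theorem momentSmall_walkSum_rowScale [IsProbabilityMeasure P]
    (hx : IsWignerArray P x) (d : ℝ) {S : ℕ → Finset ℕ} {r : ℕ → ℕ}
    (hr : ∀ᶠ N in atTop, r N ∈ S N) (n : ℕ) (h : ∀ m < n, MomentSmall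
      (fun N ω => excursionSum (scaledArray x N ω) (S N) (r N) m - limitMoment 1 m) P) :
    MomentSmall (fun N ω => walkSum
      (fun i j => (if i = r N then d else 1) * scaledArray x N ω i j) (S N) n (r N) (r N) -
        limitMoment d n) P := by
  have hmeas : ∀ n N, Measurable fun ω => walkSum
      (fun i j => (if i = r N then d else 1) * scaledArray x N ω i j) (S N) n (r N) (r N) :=
    fun n N => measurable_walkSum (U := Set.univ) (fun _ _ => trivial)
      (fun i _ j _ => (hx.measurable_scaledArray N i j).const_mul _) n _ _ trivial
  induction n using Nat.strong_induction_on with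
  | _ n ih =>
    cases n with
    | zero => simpa [walkSum_zero, limitMoment_zero] using MomentSmall.zero
    | succ n =>
      set w : ℕ → ℕ → Ω → ℝ := fun n N ω => walkSum
        (fun i j => (if i = r N then d else 1) * scaledArray x N ω i j) (S N) n (r N) (r N) with hw
      have ihs : ∀ k ≤ n, MomentSmall (fun N ω => w k N ω - limitMoment d k) P := fun k hk =>
        ih k (by omega) fun m hm => h m (by omega)
      have ihb : ∀ k ≤ n, MomentBounded (w k) P := fun k hk => by
        have := (ihs k hk).momentBounded.add (MomentBounded.const (limitMoment d k))
        simpa only [sub_add_cancel] using this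
      have h1 := ((hx.momentSmall_diag r).mul_momentBounded (ihb n le_rfl)).mul_momentBounded
        (MomentBounded.const d)
      -- E w - ℓ₁ ℓ_d = (E - ℓ₁) w + (w - ℓ_d) ℓ₁, each product having one small and one bounded
      -- factor.
      have h2 : ∀ m ∈ Finset.range n, MomentSmall (fun N ω =>
          ((excursionSum (scaledArray x N ω) (S N) (r N) m - limitMoment 1 m) *
            w (n - 1 - m) N ω + (w (n - 1 - m) N ω - limitMoment d (n - 1 - m)) *
              limitMoment 1 m) * d) P := by
        intro m hm
        rw [Finset.mem_range] at hm
        exact (((h m (by omega)).mul_momentBounded (ihb _ (by omega))).add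
          ((ihs _ (by omega)).mul_momentBounded (MomentBounded.const _))).mul_momentBounded
            (MomentBounded.const d)
      refine (h1.add (MomentSmall.sum _ h2)).congr'
        (fun N => ((hmeas (n + 1) N).sub_const _).aestronglyMeasurable) ?_
      filter_upwards [hr] with N hN
      funext ω
      rw [walkSum_succ_diag _ hN, limitMoment_succ, if_pos rfl, Finset.mul_sum, add_sub_assoc,
        ← Finset.sum_sub_distrib]
      refine congrArg₂ _ (by ring) (Finset.sum_congr rfl fun m _ => ?_)
      rw [excursionSum_rowScale]
      ring

theorem momentSmall_walkSum [IsProbabilityMeasure P] (hx : IsWignerArray P x) (n : ℕ) :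
    ∀ (S : ℕ → Finset ℕ) (r : ℕ → ℕ), (∀ N, (S N).card ≤ N + 1) →
      Tendsto (fun N => ((S N).card : ℝ) / N) atTop (𝓝 1) → (∀ᶠ N in atTop, r N ∈ S N) →
      MomentSmall (fun N ω => walkSum (scaledArray x N ω) (S N) n (r N) (r N) -
        limitMoment 1 n) P := by
  induction n using Nat.strong_induction_on with
  | _ n ih =>
    intro S r hS hlim hr
    have := hx.momentSmall_walkSum_rowScale 1 hr n fun m hm =>
      hx.momentSmall_excursionSum_sub_limitMoment hS hlim hr m (ih m hm)
    simpa only [ite_self, one_mul] using this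

end IsWignerArray

end Limit

/-! ### Matrix moments as walk sums, and the conclusion. -/

theorem zeroMoment_eq_walkSum {Ω : Type*} (d : ℝ) (x : ℕ → ℕ → Ω → ℝ) (n N : ℕ) (ω : Ω) :
    zeroMoment d x n N ω = walkSum
      (fun i j => (if i = 0 then d else 1) * scaledArray x N ω i j)
      (Finset.range (N + 1)) n 0 0 := by
  have h : productMatrix d x N ω = Matrix.of fun i j : Fin (N + 1) =>
      (if (i : ℕ) = 0 then d else 1) * scaledArray x N ω i j := by
    ext i j
    simp [productMatrix, perturbMatrix, wignerMatrix, scaledArray, Matrix.diagonal_mul]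
  rw [zeroMoment, basisVec, single_dotProduct, one_mul, Matrix.mulVec_single_one, Matrix.col_apply,
    h, matrix_pow_eq_walkSum
      (fun i j => (if i = 0 then d else 1) * scaledArray x N ω i j) (N + 1) n 0 0]
  rfl

theorem mainTheorem1 {Ω : Type*} [MeasurableSpace Ω] (P : Measure Ω) [IsProbabilityMeasure P]
    (x : ℕ → ℕ → Ω → ℝ) (hx : IsWignerArray P x) (d : ℝ) (hd : d ≠ 0) (n : ℕ) :
    (∀ N, MemLp (zeroMoment d x n N) 2 P) ∧
    Tendsto (fun N : ℕ => eLpNorm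
        (fun ω => zeroMoment d x n N ω - if Even n then dyckPi d (n / 2) else 0) 2 P)
      atTop (𝓝 0) ∧
    TendstoInMeasure P (fun N : ℕ => zeroMoment d x n N) atTop
      (fun _ => if Even n then dyckPi d (n / 2) else 0) := by
  have hmem : ∀ N, MemLp (zeroMoment d x n N) 2 P := fun N => by
    rw [funext (zeroMoment_eq_walkSum d x n N)]
    exact HasAllMoments.walkSum (fun i j => (HasAllMoments.const _).mul
      ((HasAllMoments.const _).mul (hx.hasAllMoments i j))) _ n 0 0 2
  have hcard : ∀ N, (Finset.range (N + 1)).card ≤ N + 1 := fun N => (Finset.card_range _).le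
  have hlim : Tendsto (fun N => ((Finset.range (N + 1)).card : ℝ) / N) atTop (𝓝 1) := by
    have h1 := (tendsto_const_div_atTop_nhds_zero_nat (1 : ℝ)).const_add 1
    rw [add_zero] at h1
    refine h1.congr' ?_
    filter_upwards [eventually_gt_atTop 0] with N hN
    have : (N : ℝ) ≠ 0 := by exact_mod_cast hN.ne'
    rw [Finset.card_range]
    push_cast
    field_simp
  have hr : ∀ᶠ N in atTop, (fun _ => 0 : ℕ → ℕ) N ∈ Finset.range (N + 1) :=
    Eventually.of_forall fun N => by simp
  have htend : Tendsto (fun N : ℕ => eLpNorm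
      (fun ω => zeroMoment d x n N ω - if Even n then dyckPi d (n / 2) else 0) 2 P)
      atTop (𝓝 0) := by
    simp_rw [zeroMoment_eq_walkSum]
    exact (hx.momentSmall_walkSum_rowScale d hr n fun m _ =>
      hx.momentSmall_excursionSum_sub_limitMoment hcard hlim hr m
        (hx.momentSmall_walkSum m)).tendsto 2 one_le_two
  exact ⟨hmem, htend, tendstoInMeasure_of_tendsto_eLpNorm two_ne_zero
    (fun N => (hmem N).1) aestronglyMeasurable_const htend⟩
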